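/- Let $(X_j)_{0\le j\le J}$ be a Markov process with values in a measurable space $\mathcal X$ with respect to a filtration $(\mathcal F_j)$, let $\mu_j$ be the law of $X_j$, and let $X^{j,x}$ denote the process conditioned on $X_j=x$. Let the action set $\mathcal K$ and the control set $\mathcal L$ be finite with $|\mathcal L|\ge 2$. For $0\le j\le J$ let $H_j(a,y,\cdot)$ be measurable cash-flows with $|H_j|\le C_H$, let $K_j(y,x)\subseteq\mathcal K$ be non-empty sets of admissible actions (measurable in $x$), and let $\varphi_{j+1}:\mathcal K\times\mathcal L\to\mathcal L$. The value function is $$v_j^*(y,x)=\sup_{\mathbf A}\mathsf E\Big[\sum_{\ell=j}^{J}H_\ell(A_\ell,Y_\ell,X_\ell^{j,x})\Big],\qquad Y_j=y,\quad Y_{\ell+1}=\varphi_{\ell+1}(A_\ell,Y_\ell),$$ where the supremum is over the adapted $\mathcal K$-valued processes $\mathbf A=(A_\ell)_{\ell=j}^J$ with $A_\ell\in K_\ell(Y_\ell,X_\ell)$ for all $\ell$. Put $W=JC_H$ and assume $W\ge 1$ (one may enlarge $C_H$). Let $T_W$ denote truncation at $\pm W$. Let $M\ge1$. For each $j<J$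 let $(X_j^{(m)},X_{j+1}^{(m)})$, $m=1,\dots,M$, be i.i.d. copies of $(X_j,X_{j+1})$, the samples for different $j$ being independent; let $\mathbb P_M$ be the law of all these samples. Let $\Psi_j$, $j<J$, be sets (not necessarily linear) of measurable functions $\mathcal X\to\mathbb R$. Define $v_{J,M}(y,x)=\max_{a\in K_J(y,x)}H_J(a,y,x)$ and, backwards for $j<J$, $$v_{j,M}(y,x)=\max_{a\in K_j(y,x)}\big(H_j(a,y,x)+T_W\mathcal P_j(\varphi_{j+1}(a,y),x)\big),$$ where $\mathcal P_j(z,\cdot)$ is a minimizer over $\psi\in\Psi_j$ of $\sum_{m=1}^M|v_{j+1,M}(z,X_{j+1}^{(m)})-\psi(X_j^{(m)})|^2$ that depends only on the samples of the times $k\ge j$, jointly measurably in the samples and $x$. Let $\widetilde C_j(z,x)=\mathsf E[v_{j+1,M}(z,X_{j+1}^{j,x})]$, the expectation being conditional on the samples, with $X^{j,x}$ independent of them. Let $\mathrm{VC}(\Psi_j)$ be the Vapnik–Chervonenkis dimension of the family of subgraphs $\{(x,t):t\le\psi(x)\}$, $\psi\in\Psi_j$. Then there is an absolute constant $c>0$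 such that the following holds in every such situation. If, for some $\delta>0$ and $D>0$, $$\sup_{z\in\mathcal L}\inf_{w\in\Psi_j}\big\|\widetilde C_j(z,\cdot)-w\big\|_{L_2(\mu_j\otimes\mathbb P_M)}\le\delta,\qquad \mathrm{VC}(\Psi_j)\le D,\qquad 0\le j\le J-1,$$ then, for every $0\le j\le J-1$, the function $\sup_{z\in\mathcal L}|v_{j,M}(z,\cdot)-v_j^*(z,\cdot)|$ is in $L_2(\mu_j\otimes\mathbb P_M)$ and $$\Big\|\sup_{z\in\mathcal L}\big|v_{j,M}(z,\cdot)-v_j^*(z,\cdot)\big|\Big\|_{L_2(\mu_j\otimes\mathbb P_M)}\le\Big(\sqrt{c\,W^4\,\tfrac{1+\log M}{M}\,D}+\sqrt2\,\delta\Big)\,\frac{|\mathcal L|^{J-j+1}-|\mathcal L|}{|\mathcal L|-1}.$$ The last factor grows exponentially in $J-j$: it lies between $|\mathcal L|^{J-j}$ and $2|\mathcal L|^{J-j}$. -/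

import Mathlib

open MeasureTheory ProbabilityTheory
open scoped ENNReal

noncomputable section

/-- `X` is, from time `j` up to time `J`, a Markov process with respect to the filtration `F` under
the measure `P`, with one-step transition kernels `κ`. -/
def IsMarkovFrom {Ω 𝒳 : Type*} [mΩ : MeasurableSpace Ω] [MeasurableSpace 𝒳] (J : ℕ)
    (F : Filtration ℕ mΩ) (X : ℕ → Ω → 𝒳) (κ : ℕ → Kernel 𝒳 𝒳) (j : ℕ) (P : Measure Ω) : Prop :=
  IsProbabilityMeasure P ∧
  ∀ ℓ, j ≤ ℓ → ℓ < J → ∀ B : Set 𝒳, MeasurableSet B →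
    P⟦X (ℓ + 1) ⁻¹' B | F ℓ⟧ =ᵐ[P] fun ω => (κ ℓ (X ℓ ω)).real B

/-- A stochastic control problem in discrete time `0, …, J`, with state space `𝒳`, action space `𝒦`
and control space `ℒ`; the dynamics of the state process do not depend on the control.
Only time indices up to `J` matter. -/
structure ControlProblem (Ω 𝒳 𝒦 ℒ : Type*) [mΩ : MeasurableSpace Ω] [MeasurableSpace 𝒳]
    (J : ℕ) where
  /-- the filtration -/
  F : Filtration ℕ mΩ
  /-- the state process -/
  X : ℕ → Ω → 𝒳
  /-- the one-step transition kernels of the state process -/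
  κ : ℕ → Kernel 𝒳 𝒳
  /-- the underlying probability measure -/
  P : Measure Ω
  /-- `Pcond j x` is the measure under which the state process is started from `x` at time `j`:
  under it, `X ℓ`, for `ℓ = j, …, J`, is the conditioned process `X ℓ ^ {j, x}` -/
  Pcond : ℕ → 𝒳 → Measure Ω
  /-- the cash-flows -/
  H : ℕ → 𝒦 → ℒ → 𝒳 → ℝ
  /-- the sets of admissible actions -/
  K : ℕ → ℒ → 𝒳 → Set 𝒦
  /-- the updates of the control: `Y (j + 1) = φ (j + 1) a (Y j)` -/
  φ : ℕ → 𝒦 → ℒ → ℒ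
  markovKernel : ∀ j, IsMarkovKernel (κ j)
  adapted : ∀ j ≤ J, Measurable[F j] (X j)
  markov : IsMarkovFrom J F X κ 0 P
  markov_cond : ∀ j ≤ J, ∀ x, IsMarkovFrom J F X κ j (Pcond j x)
  start_cond : ∀ j ≤ J, ∀ x, (Pcond j x).map (X j) = Measure.dirac x
  measurable_H : ∀ j ≤ J, ∀ a y, Measurable (H j a y)
  measurable_K : ∀ j ≤ J, ∀ a y, MeasurableSet {x | a ∈ K j y x}
  nonempty_K : ∀ j ≤ J, ∀ y x, (K j y x).Nonempty

/-- A family `A` of sets shatters the finite set `T`: it cuts out every subset of `T`. -/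
def FamilyShatters {α : Type*} (A : Set (Set α)) (T : Finset α) : Prop :=
  ∀ U ⊆ (T : Set α), ∃ S ∈ A, (T : Set α) ∩ S = U

/-- The Vapnik-Chervonenkis dimension of a family of sets. -/
def familyVCDim {α : Type*} (A : Set (Set α)) : ℕ∞ :=
  ⨆ (T : Finset α) (_ : FamilyShatters A T), (T.card : ℕ∞)

/-- The Vapnik-Chervonenkis dimension of a class of functions: that of its family of subgraphs. -/
def functionVCDim {𝒳 : Type*} (Ψ : Set (𝒳 → ℝ)) : ℕ∞ :=
  familyVCDim {G : Set (𝒳 × ℝ) | ∃ f ∈ Ψ, G = {q | q.2 ≤ f q.1}}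

/-- Truncation at the level `W`. -/
def truncate (W r : ℝ) : ℝ := if |r| ≤ W then r else W * Real.sign r

/-- The training data: for every `j < J` a sample, of size `M`, of pairs
`(s j m).1 = X_j^{(m)}` and `(s j m).2 = X_{j+1}^{(m)}`. -/
abbrev Sample (𝒳 : Type*) (J M : ℕ) : Type _ := Fin J → Fin M → 𝒳 × 𝒳

namespace ControlProblem

variable {Ω 𝒳 𝒦 ℒ : Type*} [MeasurableSpace Ω] [MeasurableSpace 𝒳] {J : ℕ}

/-- The control process `Y ℓ (a; j, y)`, `ℓ ≥ j`, started from `y` at time `j` and driven by the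
actions `a`. (For `ℓ < j` it has the irrelevant value `y`.) -/
def controlPath (Q : ControlProblem Ω 𝒳 𝒦 ℒ J) (a : ℕ → 𝒦) (j : ℕ) (y : ℒ) : ℕ → ℒ
  | 0 => y
  | ℓ + 1 => if ℓ < j then y else Q.φ (ℓ + 1) (a ℓ) (Q.controlPath a j y ℓ)

/-- The admissible policies from time `j` on, for the control value `y` at time `j`: adapted
action processes that take admissible actions only. -/
def admissible (Q : ControlProblem Ω 𝒳 𝒦 ℒ J) (j : ℕ) (y : ℒ) : Set (ℕ → Ω → 𝒦) :=
  {A | ∀ ℓ, j ≤ ℓ → ℓ ≤ J →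
    (∀ a, MeasurableSet[Q.F ℓ] {ω | A ℓ ω = a}) ∧
    ∀ ω, A ℓ ω ∈ Q.K ℓ (Q.controlPath (fun i => A i ω) j y ℓ) (Q.X ℓ ω)}

/-- The value function `v*_j(y, x)`: the supremum over the admissible policies of the expected
sum of the cash-flows at the times `j, …, J`, when the state process is conditioned to be in `x`
at time `j`. -/
def value (Q : ControlProblem Ω 𝒳 𝒦 ℒ J) (j : ℕ) (y : ℒ) (x : 𝒳) : ℝ :=
  sSup ((fun A : ℕ → Ω → 𝒦 => ∫ ω, ∑ ℓ ∈ Finset.Icc j J,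
    Q.H ℓ (A ℓ ω) (Q.controlPath (fun i => A i ω) j y ℓ) (Q.X ℓ ω) ∂(Q.Pcond j x))
    '' Q.admissible j y)

/-- `μ_j`, the distribution of `X_j`. -/
def stateLaw (Q : ControlProblem Ω 𝒳 𝒦 ℒ J) (j : ℕ) : Measure 𝒳 := Q.P.map (Q.X j)

/-- The law of the training data: all pairs are independent, those with index `j` have the joint
distribution of `(X_j, X_{j+1})`. -/
def sampleLaw (Q : ControlProblem Ω 𝒳 𝒦 ℒ J) (M : ℕ) : Measure (Sample 𝒳 J M) :=
  Measure.pi fun j : Fin J => Measure.pi fun _ : Fin M =>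
    Q.P.map fun ω => (Q.X j ω, Q.X (j + 1) ω)

/-- The estimated value functions `v_{j,M}(y, x)`, computed from the empirical projections
`p j z s` (at time `j`, for the control `z` and the training data `s`) with truncation at `W`. -/
def estValue (Q : ControlProblem Ω 𝒳 𝒦 ℒ J) {M : ℕ} (W : ℝ)
    (p : ℕ → ℒ → Sample 𝒳 J M → 𝒳 → ℝ) (j : ℕ) (y : ℒ) (s : Sample 𝒳 J M) (x : 𝒳) : ℝ :=
  sSup ((fun a => Q.H j a y x + if j < J then truncate W (p j (Q.φ (j + 1) a y) s x) else 0)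
    '' Q.K j y x)

/-- `p` is a system of empirical projections onto the classes `Ψ j`, `j < J`: for every control
`z`, `p j z s ∈ Ψ j` minimizes the empirical squared error of the regression of
`v_{j+1,M}(z, X_{j+1}^{(m)})` on `X_j^{(m)}`; it is a measurable random function and uses the
data of the times `k ≥ j` only. -/
structure IsEmpiricalProjection (Q : ControlProblem Ω 𝒳 𝒦 ℒ J) {M : ℕ} (W : ℝ)
    (Ψ : ℕ → Set (𝒳 → ℝ)) (p : ℕ → ℒ → Sample 𝒳 J M → 𝒳 → ℝ) : Prop where
  mem : ∀ (j : Fin J) (z : ℒ) (s : Sample 𝒳 J M), p j z s ∈ Ψ j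
  minimal : ∀ (j : Fin J) (z : ℒ) (s : Sample 𝒳 J M), ∀ ψ ∈ Ψ j,
    ∑ m, |Q.estValue W p (j + 1) z s (s j m).2 - p j z s (s j m).1| ^ 2 ≤
      ∑ m, |Q.estValue W p (j + 1) z s (s j m).2 - ψ (s j m).1| ^ 2
  measurable : ∀ (j : Fin J) (z : ℒ),
    Measurable fun q : Sample 𝒳 J M × 𝒳 => p j z q.1 q.2
  nonanticipating : ∀ (j : Fin J) (z : ℒ) (s s' : Sample 𝒳 J M),
    (∀ k, j ≤ k → s k = s' k) → p j z s = p j z s'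

/-- `C̃_j(z, x)`: the conditional expectation, given the training data `s`, of
`v_{j+1,M}(z, X_{j+1}^{j,x})`, for a state process independent of the training data. -/
def contTilde (Q : ControlProblem Ω 𝒳 𝒦 ℒ J) {M : ℕ} (W : ℝ)
    (p : ℕ → ℒ → Sample 𝒳 J M → 𝒳 → ℝ) (j : ℕ) (z : ℒ) (s : Sample 𝒳 J M) (x : 𝒳) : ℝ :=
  ∫ ω, Q.estValue W p (j + 1) z s (Q.X (j + 1) ω) ∂(Q.Pcond j x)

end ControlProblem

end

/-! At each time the error splits into a fresh regression error and the error inherited from the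
next time. By the dynamic programming principle (`value_eq_dpValue`) v* solves the Bellman
recursion. Maxima over actions are 1-Lipschitz, and T_W is a contraction fixing the true
continuation values, which are bounded by J·C_H = W. So the error at time j, uniform in the control,
is at most ∑_z |T_{2W} 𝒫_j(z) − C̃_j(z)| plus the transition kernel applied to the uniform error at
j+1 (`estError_le`). The kernel is a contraction from L²(μ_{j+1}) to L²(μ_j)
(`eLpNorm_integral_kernel_le`), so the errors merely add up: the total is (J−j)|ℒ| regression
errors, which is below the geometric factor.

For one regression, freeze all sample blocks except block j. Then v_{j+1,M} is a fixed bounded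
function, C̃_j is its regression function m, and 𝒫_j is least squares on an i.i.d. sample. The
excess loss h of a truncated ψ has mean ‖Tψ − m‖² and satisfies the Bernstein condition E h² ≤ κ E
h. This gives the rate log M / M without a square root: after a ghost sample is introduced, E h − 2
P_M h (with P_M the empirical mean) is dominated by a mean of `offsetTerm`s, whose antisymmetric
part receives random signs while a negative quadratic part stays. Over N functions a Rademacher sum
with such an offset has expected maximum of order κ log N (`integral_excess_sub_empirical_le`).
Sauer–Shelah for subgraphs on a grid of sample points and levels gives a net with log N of order d(1
+ log M) (`exists_truncate_cover`). Minimality bounds P_M h by the empirical excess loss of any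
fixed w in the class, whose mean is ‖w − m‖²; the factor 2 becomes the √2 in front of δ. -/

section OffsetRademacher

/-! ### Rademacher sums with a quadratic offset. -/

/-- The sign `±1` attached to a Boolean. -/
def boolSign (b : Bool) : ℝ := if b then -1 else 1

/-- The sum over signs factorizes, and cosh x ≤ exp(x²/2) makes each factor at most 2: the quadratic
offset exactly compensates the sub-Gaussian growth. -/
theorem sum_exp_boolSign_le {M : ℕ} (a : Fin M → ℝ) (l : ℝ) :
    ∑ σ : Fin M → Bool, Real.exp (∑ k, (l * (boolSign (σ k) * a k) - l ^ 2 / 2 * a k ^ 2)) ≤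
      2 ^ M := by
  classical
  have h1 : ∀ σ : Fin M → Bool,
      Real.exp (∑ k, (l * (boolSign (σ k) * a k) - l ^ 2 / 2 * a k ^ 2)) =
        ∏ k, Real.exp (l * (boolSign (σ k) * a k) - l ^ 2 / 2 * a k ^ 2) := fun σ =>
    Real.exp_sum _ _
  simp_rw [h1]
  have h2 := Finset.prod_univ_sum (fun _ : Fin M => (Finset.univ : Finset Bool))
    (fun k b => Real.exp (l * (boolSign b * a k) - l ^ 2 / 2 * a k ^ 2))
  rw [Fintype.piFinset_univ] at h2
  rw [← h2]
  have h3 : ∀ k : Fin M,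
      ∑ b : Bool, Real.exp (l * (boolSign b * a k) - l ^ 2 / 2 * a k ^ 2) ≤ 2 := by
    intro k
    have h4 := Real.cosh_le_exp_half_sq (l * a k)
    rw [Real.cosh_eq] at h4
    have h5 : Real.exp ((l * a k) ^ 2 / 2) * Real.exp (-((l * a k) ^ 2 / 2)) = 1 := by
      rw [← Real.exp_add]; simp
    have h6 := mul_le_mul_of_nonneg_right h4 (Real.exp_pos (-((l * a k) ^ 2 / 2))).le
    rw [h5] at h6
    have e1 : Real.exp (l * (boolSign true * a k) - l ^ 2 / 2 * a k ^ 2) =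
        Real.exp (-(l * a k)) * Real.exp (-((l * a k) ^ 2 / 2)) := by
      rw [← Real.exp_add]; congr 1; simp [boolSign]; ring
    have e2 : Real.exp (l * (boolSign false * a k) - l ^ 2 / 2 * a k ^ 2) =
        Real.exp (l * a k) * Real.exp (-((l * a k) ^ 2 / 2)) := by
      rw [← Real.exp_add]; congr 1; simp [boolSign]; ring
    rw [Fintype.sum_bool, e1, e2]
    linarith
  calc _ ≤ ∏ _k : Fin M, (2 : ℝ) :=
        Finset.prod_le_prod (fun k _ => Finset.sum_nonneg fun b _ => (Real.exp_pos _).le)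
          fun k _ => h3 k
    _ = 2 ^ M := by simp

/-- The expectation over random signs of a maximum of finitely many Rademacher sums with a
quadratic offset. -/
theorem sum_offset_le_log_card {ι : Type*} {M : ℕ} (T : Finset ι) (a : ι → Fin M → ℝ) {l : ℝ}
    (hl : 0 < l) (t : (Fin M → Bool) → ι) (ht : ∀ σ, t σ ∈ T) :
    ∑ σ : Fin M → Bool, ∑ k, (boolSign (σ k) * a (t σ) k - l / 2 * a (t σ) k ^ 2) ≤
      2 ^ M * (Real.log T.card / l) := by
  have hT : (0 : ℝ) < T.card := by
    exact_mod_cast Finset.card_pos.2 ⟨_, ht fun _ => true⟩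
  set L := Real.log T.card with hL
  set E : ι → (Fin M → Bool) → ℝ := fun i σ =>
    ∑ k, (l * (boolSign (σ k) * a i k) - l ^ 2 / 2 * a i k ^ 2) with hE
  have h1 : ∀ σ, E (t σ) σ ≤ L - 1 + (∑ i ∈ T, Real.exp (E i σ)) / T.card := by
    intro σ
    -- The tangent line of `exp` at L = log |T| plays the role of Jensen's inequality; the
    -- exponential at the selected index is then bounded by the sum over T.
    have h2 := Real.add_one_le_exp (E (t σ) σ - L)
    rw [Real.exp_sub, hL, Real.exp_log hT] at h2
    have h3 : Real.exp (E (t σ) σ) ≤ ∑ i ∈ T, Real.exp (E i σ) :=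
      Finset.single_le_sum (f := fun i => Real.exp (E i σ)) (fun i _ => (Real.exp_pos _).le) (ht σ)
    have h4 := div_le_div_of_nonneg_right h3 hT.le
    linarith
  have h5 : ∑ σ, E (t σ) σ ≤ 2 ^ M * L := by
    calc ∑ σ, E (t σ) σ ≤ ∑ σ, (L - 1 + (∑ i ∈ T, Real.exp (E i σ)) / T.card) :=
          Finset.sum_le_sum fun σ _ => h1 σ
      _ = 2 ^ M * (L - 1) + (∑ i ∈ T, ∑ σ, Real.exp (E i σ)) / T.card := by
          rw [Finset.sum_add_distrib, ← Finset.sum_div, Finset.sum_comm]; simp [mul_sub]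
      _ ≤ 2 ^ M * (L - 1) + (∑ _i ∈ T, (2 : ℝ) ^ M) / T.card := by
          gcongr with i _
          exact sum_exp_boolSign_le (a i) l
      _ = 2 ^ M * L := by
          rw [Finset.sum_const, nsmul_eq_mul, mul_div_cancel_left₀ _ hT.ne', mul_sub, mul_one,
            sub_add_cancel]
  have h6 : ∀ σ, ∑ k, (boolSign (σ k) * a (t σ) k - l / 2 * a (t σ) k ^ 2) = E (t σ) σ / l := by
    intro σ
    rw [hE, Finset.sum_div]
    refine Finset.sum_congr rfl fun k _ => ?_
    field_simp
  simp_rw [h6]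
  rw [← Finset.sum_div, mul_div_assoc']
  gcongr

/-- The one-point term of the symmetrized process: `u`, `u'` are the values of the excess loss
at the two copies. -/
noncomputable def offsetTerm (κ u u' : ℝ) : ℝ :=
  (2 * u' - u' ^ 2 / (2 * κ)) - (2 * u - u ^ 2 / (2 * κ)) - (u ^ 2 + u' ^ 2) / (2 * κ)

theorem offsetTerm_sub_le {κ η u u' w w' : ℝ} (hκ : 0 < κ) (hu : |u'| ≤ κ)
    (hw : |w'| ≤ κ) (h : |u - w| ≤ η) (h' : |u' - w'| ≤ η) :
    offsetTerm κ u u' ≤ offsetTerm κ w w' + 6 * η := by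
  have e : offsetTerm κ u u' - offsetTerm κ w w' =
      2 * (u' - w') - 2 * (u - w) - (u' - w') * ((u' + w') / κ) := by
    unfold offsetTerm; field_simp; ring
  have h1 : |(u' + w') / κ| ≤ 2 := by
    rw [abs_div, abs_of_pos hκ, div_le_iff₀ hκ]
    linarith [abs_add_le u' w']
  have h2 : |(u' - w') * ((u' + w') / κ)| ≤ η * 2 := by
    rw [abs_mul]
    exact mul_le_mul h' h1 (abs_nonneg _) ((abs_nonneg _).trans h')
  linarith [abs_le.1 h, abs_le.1 h', abs_le.1 h2]

/-- With g(r) = 2r − r²/(2κ) one has |g(r)| ≤ (5/2)|r| on [−κ, κ], so (g(u') − g(u))² ≤ (25/2)(u² +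
u'²), and the symmetric part of `offsetTerm` pays for an offset with l = 2/(25κ). A swap only flips
the sign of g(u') − g(u). -/
theorem offsetTerm_le {κ u u' : ℝ} (hκ : 0 < κ) (hu : |u| ≤ κ) (hu' : |u'| ≤ κ) (b : Bool) :
    offsetTerm κ (if b then u' else u) (if b then u else u') ≤
      boolSign b * ((2 * u' - u' ^ 2 / (2 * κ)) - (2 * u - u ^ 2 / (2 * κ))) -
      (2 / (25 * κ)) / 2 * ((2 * u' - u' ^ 2 / (2 * κ)) - (2 * u - u ^ 2 / (2 * κ))) ^ 2 := by
  have key : ∀ r : ℝ, |r| ≤ κ → (2 * r - r ^ 2 / (2 * κ)) ^ 2 ≤ 25 / 4 * r ^ 2 := by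
    intro r hr
    have e : 2 * r - r ^ 2 / (2 * κ) = r * (2 - r / (2 * κ)) := by field_simp
    have h1 : |r / (2 * κ)| ≤ 1 / 2 := by
      rw [abs_div, abs_of_pos (by positivity : 0 < 2 * κ), div_le_iff₀ (by positivity)]; linarith
    have h2 := abs_le.1 h1
    have h3 : (2 - r / (2 * κ)) ^ 2 ≤ 25 / 4 := by nlinarith
    rw [e, mul_pow]
    nlinarith [sq_nonneg r]
  have k1 := key u hu
  have k2 := key u' hu'
  set g := 2 * u - u ^ 2 / (2 * κ) with hg
  set g' := 2 * u' - u' ^ 2 / (2 * κ) with hg'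
  have h1 : (g' - g) ^ 2 ≤ 25 / 2 * (u ^ 2 + u' ^ 2) := by nlinarith [sq_nonneg (g' + g)]
  have h2 : (2 / (25 * κ)) / 2 * (g' - g) ^ 2 ≤ (u ^ 2 + u' ^ 2) / (2 * κ) := by
    rw [div_div, div_mul_eq_mul_div, div_le_div_iff₀ (by positivity) (by positivity)]
    nlinarith
  have e : (u ^ 2 + u' ^ 2) / (2 * κ) = (u' ^ 2 + u ^ 2) / (2 * κ) := by rw [add_comm]
  cases b <;> simp only [offsetTerm, boolSign, if_true, if_false, Bool.false_eq_true] <;> linarith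

/-- The index may depend on the signs, because after a swap the estimator is trained on other
points. The net T depends on ω only; moving to it costs 6η per point, and 1/l = 25κ/2 multiplies the
logarithm. -/
theorem sum_offsetTerm_swap_le {ι E : Type*} {M : ℕ} (h : ι → E → ℝ) (T : Finset ι)
    {κ η : ℝ} (hκ : 0 < κ) (hb : ∀ i e, |h i e| ≤ κ) (ω : Fin M → E × E)
    (I : Set ι) (hT : ∀ i ∈ I, ∃ i' ∈ T, ∀ k, |h i (ω k).1 - h i' (ω k).1| ≤ η ∧
      |h i (ω k).2 - h i' (ω k).2| ≤ η)
    (i : (Fin M → Bool) → ι) (hi : ∀ σ, i σ ∈ I) :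
    ∑ σ : Fin M → Bool, ∑ k, offsetTerm κ (h (i σ) (if σ k then (ω k).swap else ω k).1)
        (h (i σ) (if σ k then (ω k).swap else ω k).2) ≤
      2 ^ M * (25 / 2 * κ * Real.log T.card + M * (6 * η)) := by
  choose! c hcT hc using hT
  set a : ι → Fin M → ℝ := fun i k =>
    (2 * h i (ω k).2 - h i (ω k).2 ^ 2 / (2 * κ)) - (2 * h i (ω k).1 - h i (ω k).1 ^ 2 / (2 * κ))
    with ha
  have h1 := sum_offset_le_log_card T a (l := 2 / (25 * κ)) (by positivity) (fun σ => c (i σ))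
    fun σ => hcT _ (hi σ)
  have h2 : ∀ σ k, offsetTerm κ (h (i σ) (if σ k then (ω k).swap else ω k).1)
        (h (i σ) (if σ k then (ω k).swap else ω k).2) ≤
      (boolSign (σ k) * a (c (i σ)) k - (2 / (25 * κ)) / 2 * a (c (i σ)) k ^ 2) + 6 * η := by
    intro σ k
    obtain ⟨h3, h4⟩ := hc _ (hi σ) k
    have h5 := offsetTerm_le hκ (hb (c (i σ)) (ω k).1) (hb (c (i σ)) (ω k).2) (σ k)
    refine le_trans ?_ (add_le_add_left h5 _)
    have := offsetTerm_sub_le (η := η) hκ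
      (hb (i σ) (if σ k then (ω k).swap else ω k).2)
      (hb (c (i σ)) (if σ k then (ω k).swap else ω k).2)
      (u := h (i σ) (if σ k then (ω k).swap else ω k).1)
      (w := h (c (i σ)) (if σ k then (ω k).swap else ω k).1)
      (by cases σ k <;> simpa) (by cases σ k <;> simpa)
    refine this.trans (le_of_eq ?_)
    cases σ k <;> simp
  calc _ ≤ ∑ σ : Fin M → Bool, ∑ k : Fin M, ((boolSign (σ k) * a (c (i σ)) k -
          (2 / (25 * κ)) / 2 * a (c (i σ)) k ^ 2) + 6 * η) :=
        Finset.sum_le_sum fun σ _ => Finset.sum_le_sum fun k _ => h2 σ k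
    _ = ∑ σ : Fin M → Bool, ∑ k : Fin M, (boolSign (σ k) * a (c (i σ)) k -
          (2 / (25 * κ)) / 2 * a (c (i σ)) k ^ 2) + 2 ^ M * (M * (6 * η)) := by
        simp only [Finset.sum_add_distrib]; simp
    _ ≤ _ := by
        rw [mul_add]
        refine add_le_add_left (h1.trans (le_of_eq ?_)) _
        field_simp

end OffsetRademacher

/-! ### Symmetrization with a ghost sample. -/

section Symmetrization

variable {E : Type*} [MeasurableSpace E] (ν : Measure E) [IsProbabilityMeasure ν] {M : ℕ}

/-- This asymmetric form is what averaging over the ghost copy uses; the definition displays the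
part that changes sign and the part that is invariant when the copies are exchanged. -/
theorem offsetTerm_eq {κ : ℝ} (hκ : 0 < κ) (u u' : ℝ) :
    offsetTerm κ u u' = 2 * u' - 2 * u - u' ^ 2 / κ := by
  unfold offsetTerm; field_simp; ring

theorem measurePreserving_swap_pi (σ : Fin M → Bool) :
    MeasurePreserving (fun (ω : Fin M → E × E) k => if σ k then (ω k).swap else ω k)
      (Measure.pi fun _ => ν.prod ν) (Measure.pi fun _ => ν.prod ν) := by
  refine measurePreserving_pi _ _ (f := fun k (e : E × E) => if σ k then e.swap else e) fun k => ?_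
  by_cases hk : σ k
  · simpa [hk] using Measure.measurePreserving_swap (μ := ν) (ν := ν)
  · simp only [hk, Bool.false_eq_true, if_false]
    exact MeasurePreserving.id (ν.prod ν)

theorem measurable_offsetTerm {α : Type*} [MeasurableSpace α] {κ : ℝ} {u u' : α → ℝ}
    (hu : Measurable u) (hu' : Measurable u') : Measurable fun a => offsetTerm κ (u a) (u' a) := by
  unfold offsetTerm; fun_prop

theorem abs_offsetTerm_le {κ u u' : ℝ} (hκ : 0 < κ) (hu : |u| ≤ κ) (hu' : |u'| ≤ κ) :
    |offsetTerm κ u u'| ≤ 5 * κ := by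
  have h1 : u' ^ 2 / κ ≤ κ := by
    rw [div_le_iff₀ hκ, ← sq_abs]; nlinarith [abs_nonneg u']
  have h2 : 0 ≤ u' ^ 2 / κ := by positivity
  rw [offsetTerm_eq hκ, abs_le]
  have := abs_le.1 hu; have := abs_le.1 hu'
  constructor <;> linarith

theorem integrable_of_abs_le {α : Type*} [MeasurableSpace α] {μ : Measure α} [IsFiniteMeasure μ]
    {f : α → ℝ} {C : ℝ} (hf : Measurable f) (h : ∀ a, |f a| ≤ C) : Integrable f μ :=
  Integrable.of_bound hf.aestronglyMeasurable C (Filter.Eventually.of_forall h)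

/-- The process is evaluated at the estimator itself rather than at a supremum over the class, so
joint measurability of the estimator suffices and no measurability of suprema enters. -/
theorem integral_excess_sub_empirical_le {ι : Type*} (hM : 0 < M) (h : ι → E → ℝ)
    (f : (Fin M → E) → ι) (hf : Measurable fun q : (Fin M → E) × E => h (f q.1) q.2)
    {κ η : ℝ} (hκ : 0 < κ) (hb : ∀ i e, |h i e| ≤ κ)
    (hvar : ∀ S, ∫ e, h (f S) e ^ 2 ∂ν ≤ κ * ∫ e, h (f S) e ∂ν)
    (I : Set ι) (hfI : ∀ S, f S ∈ I) (N : ℝ)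
    (hcover : ∀ ω : Fin M → E × E, ∃ T : Finset ι, (T.card : ℝ) ≤ N ∧
      ∀ i ∈ I, ∃ i' ∈ T, ∀ k, |h i (ω k).1 - h i' (ω k).1| ≤ η ∧
        |h i (ω k).2 - h i' (ω k).2| ≤ η) :
    ∫ S, (∫ e, h (f S) e ∂ν - 2 * ((∑ k, h (f S) (S k)) / M)) ∂(Measure.pi fun _ : Fin M => ν) ≤
      25 / 2 * κ * Real.log N / M + 6 * η := by
  have hM' : (0 : ℝ) < M := by exact_mod_cast hM
  have hS : ∀ S, Measurable (h (f S)) := fun S => hf.comp measurable_prodMk_left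
  set G : (Fin M → E) × (Fin M → E) → ℝ := fun q =>
    ∑ k, offsetTerm κ (h (f q.1) (q.1 k)) (h (f q.1) (q.2 k)) with hG
  have hGm : Measurable G := by
    refine Finset.measurable_sum _ fun k _ => measurable_offsetTerm ?_ ?_
    · exact hf.comp (f := fun q : (Fin M → E) × (Fin M → E) => (q.1, q.1 k)) (by fun_prop)
    · exact hf.comp (f := fun q : (Fin M → E) × (Fin M → E) => (q.1, q.2 k)) (by fun_prop)
  have hGb : ∀ q, |G q| ≤ ∑ _k : Fin M, 5 * κ := fun q =>
    (Finset.abs_sum_le_sum_abs _ _).trans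
      (Finset.sum_le_sum fun k _ => abs_offsetTerm_le hκ (hb _ _) (hb _ _))
  have hpi : ∀ (S : Fin M → E) (k : Fin M) (g : E → ℝ), Measurable g →
      ∫ S' : Fin M → E, g (S' k) ∂(Measure.pi fun _ : Fin M => ν) = ∫ e, g e ∂ν := by
    intro S k g hg
    exact (measurePreserving_eval (fun _ : Fin M => ν) k).hasLaw.integral_comp
      hg.aestronglyMeasurable
  have hA : ∀ S, ∫ e, h (f S) e ∂ν - 2 * ((∑ k, h (f S) (S k)) / M) ≤
      (∫ S', G (S, S') ∂(Measure.pi fun _ : Fin M => ν)) / M := by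
    intro S
    have h1 : ∫ S', G (S, S') ∂(Measure.pi fun _ : Fin M => ν) =
        ∑ k, (2 * (∫ e, h (f S) e ∂ν) - 2 * h (f S) (S k) - (∫ e, h (f S) e ^ 2 ∂ν) / κ) := by
      rw [hG, integral_finsetSum]
      · refine Finset.sum_congr rfl fun k _ => ?_
        rw [hpi S k (fun e => offsetTerm κ (h (f S) (S k)) (h (f S) e))
          (measurable_offsetTerm measurable_const (hS S))]
        simp_rw [offsetTerm_eq hκ]
        have i1 : Integrable (h (f S)) ν := integrable_of_abs_le (hS S) (hb _)
        have i2 : Integrable (fun e => h (f S) e ^ 2) ν :=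
          integrable_of_abs_le (C := κ ^ 2) ((hS S).pow_const 2) fun e => by
            rw [abs_pow]; exact pow_le_pow_left₀ (abs_nonneg _) (hb _ _) 2
        have i3 : Integrable (fun e => 2 * h (f S) e - 2 * h (f S) (S k)) ν :=
          (i1.const_mul 2).sub (integrable_const _)
        rw [integral_sub i3 (i2.div_const κ),
          integral_sub (i1.const_mul 2) (integrable_const _), integral_const_mul, integral_div]
        simp
      · intro k _
        refine integrable_of_abs_le (C := 5 * κ) ?_ fun S' => abs_offsetTerm_le hκ (hb _ _) (hb _ _)
        exact measurable_offsetTerm (u := fun _ => h (f S) (S k)) measurable_const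
          ((hS S).comp (measurable_pi_apply k))
    rw [h1, le_div_iff₀ hM', Finset.sum_sub_distrib, Finset.sum_sub_distrib, ← Finset.mul_sum]
    -- The Bernstein condition enters here: 2 E h − E h²/κ ≥ E h.
    have h2 := hvar S
    have h3 : (∫ e, h (f S) e ^ 2 ∂ν) / κ ≤ ∫ e, h (f S) e ∂ν := by
      rw [div_le_iff₀ hκ]; linarith
    have h4 := mul_le_mul_of_nonneg_left h3 hM'.le
    simp only [Finset.sum_const, Finset.card_univ, Fintype.card_fin, nsmul_eq_mul]
    rw [← Finset.mul_sum, sub_mul, mul_assoc 2, div_mul_cancel₀ _ hM'.ne']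
    linarith
  have hGi : Integrable G ((Measure.pi fun _ : Fin M => ν).prod (Measure.pi fun _ : Fin M => ν)) :=
    integrable_of_abs_le hGm hGb
  have hB : ∫ S, ∫ S', G (S, S') ∂(Measure.pi fun _ : Fin M => ν) ∂(Measure.pi fun _ : Fin M => ν) =
      ∫ ω : Fin M → E × E, G (fun k => (ω k).1, fun k => (ω k).2)
        ∂(Measure.pi fun _ => ν.prod ν) := by
    rw [← integral_prod _ hGi]
    exact ((measurePreserving_arrowProdEquivProdArrow E E (Fin M) (fun _ => ν)
      (fun _ => ν)).integral_comp' G).symm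
  set G' : (Fin M → E × E) → ℝ := fun ω => G (fun k => (ω k).1, fun k => (ω k).2) with hG'
  have hG'm : Measurable G' := hGm.comp (by fun_prop)
  -- Exchanging points with their ghosts preserves the law, so the mean of G' is also the mean of
  -- its average over all 2^M swaps; that average is bounded pointwise in ω.
  have hC : ∀ σ : Fin M → Bool,
      ∫ ω : Fin M → E × E, G' (fun k => if σ k then (ω k).swap else ω k)
        ∂(Measure.pi fun _ => ν.prod ν) = ∫ ω, G' ω ∂(Measure.pi fun _ => ν.prod ν) := fun σ =>
    (measurePreserving_swap_pi ν σ).hasLaw.integral_comp hG'm.aestronglyMeasurable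
  have hG'i : ∀ σ : Fin M → Bool, Integrable
      (fun ω : Fin M → E × E => G' (fun k => if σ k then (ω k).swap else ω k))
      (Measure.pi fun _ => ν.prod ν) := fun σ =>
    integrable_of_abs_le (hG'm.comp (measurePreserving_swap_pi ν σ).measurable) fun ω => hGb _
  have hD : ∀ ω : Fin M → E × E,
      ∑ σ : Fin M → Bool, G' (fun k => if σ k then (ω k).swap else ω k) ≤
      2 ^ M * (25 / 2 * κ * Real.log N + M * (6 * η)) := by
    intro ω
    obtain ⟨T, hTN, hT⟩ := hcover ω
    have hne : T.Nonempty := by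
      obtain ⟨i', hi', -⟩ := hT _ (hfI fun k => (ω k).1)
      exact ⟨i', hi'⟩
    have hTpos : (0 : ℝ) < T.card := by exact_mod_cast hne.card_pos
    refine (sum_offsetTerm_swap_le h T hκ hb ω I hT
      (fun σ => f fun k => (if σ k then (ω k).swap else ω k).1) fun σ => hfI _).trans ?_
    have := Real.log_le_log hTpos hTN
    gcongr
  have hE : ∫ ω, G' ω ∂(Measure.pi fun _ : Fin M => ν.prod ν) ≤
      25 / 2 * κ * Real.log N + M * (6 * η) := by
    have h1 : (2 : ℝ) ^ M * ∫ ω, G' ω ∂(Measure.pi fun _ : Fin M => ν.prod ν) =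
        ∫ ω, ∑ σ : Fin M → Bool, G' (fun k => if σ k then (ω k).swap else ω k)
          ∂(Measure.pi fun _ => ν.prod ν) := by
      rw [integral_finsetSum _ fun σ _ => hG'i σ]
      simp_rw [hC]
      simp
    have h2 : ∫ ω, ∑ σ : Fin M → Bool, G' (fun k => if σ k then (ω k).swap else ω k)
          ∂(Measure.pi fun _ => ν.prod ν) ≤
        ∫ _ω : Fin M → E × E, (2 ^ M * (25 / 2 * κ * Real.log N + M * (6 * η)))
          ∂(Measure.pi fun _ => ν.prod ν) :=
      integral_mono (integrable_finsetSum _ fun σ _ => hG'i σ) (integrable_const _) hD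
    rw [← h1] at h2
    simp only [integral_const, probReal_univ, one_smul] at h2
    exact le_of_mul_le_mul_left h2 (by positivity)
  have hint : Integrable (fun S => ∫ e, h (f S) e ∂ν - 2 * ((∑ k, h (f S) (S k)) / M))
      (Measure.pi fun _ : Fin M => ν) := by
    have m1 : Measurable fun S : Fin M → E => ∫ e, h (f S) e ∂ν :=
      (hf.stronglyMeasurable.integral_prod_right').measurable
    have m2 : ∀ k, Measurable fun S : Fin M → E => h (f S) (S k) := fun k =>
      hf.comp (f := fun S : Fin M → E => (S, S k)) (by fun_prop)
    have i1 : Integrable (fun S : Fin M → E => ∫ e, h (f S) e ∂ν) (Measure.pi fun _ => ν) :=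
      integrable_of_abs_le (C := κ) m1 fun S => by
        have := norm_integral_le_of_norm_le_const (μ := ν) (f := h (f S)) (C := κ)
          (Filter.Eventually.of_forall fun e => hb _ e)
        simpa using this
    have i2 : Integrable (fun S : Fin M → E => ∑ k, h (f S) (S k)) (Measure.pi fun _ => ν) :=
      integrable_finsetSum _ fun k _ => integrable_of_abs_le (m2 k) fun S => hb _ _
    exact i1.sub ((i2.div_const _).const_mul 2)
  calc _ ≤ ∫ S, (∫ S', G (S, S') ∂(Measure.pi fun _ : Fin M => ν)) / M
          ∂(Measure.pi fun _ : Fin M => ν) :=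
        integral_mono hint (hGi.integral_prod_left.div_const _) hA
    _ = (∫ ω, G' ω ∂(Measure.pi fun _ : Fin M => ν.prod ν)) / M := by
        rw [integral_div, hB]
    _ ≤ (25 / 2 * κ * Real.log N + M * (6 * η)) / M := by gcongr
    _ = _ := by field_simp

end Symmetrization

/-! ### Truncation as a contraction. -/

section Truncate

theorem truncate_eq {B : ℝ} (hB : 0 ≤ B) (r : ℝ) : truncate B r = max (-B) (min r B) := by
  unfold truncate
  split_ifs with h
  · rw [abs_le] at h
    rw [min_eq_left h.2, max_eq_right h.1]
  · rw [abs_le, not_and_or, not_le, not_le] at h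
    rcases h with h | h
    · rw [Real.sign_of_neg (by linarith), max_eq_left]
      · ring
      · exact (min_le_left _ _).trans h.le
    · rw [Real.sign_of_pos (by linarith), min_eq_right h.le, max_eq_right (by linarith), mul_one]

theorem abs_truncate_le {B : ℝ} (hB : 0 ≤ B) (r : ℝ) : |truncate B r| ≤ B := by
  rw [truncate_eq hB, abs_le]
  exact ⟨le_max_left _ _, max_le (by linarith) (min_le_right _ _)⟩

theorem truncate_of_abs_le {B r : ℝ} (h : |r| ≤ B) : truncate B r = r := if_pos h

theorem abs_truncate_sub_truncate_le {B : ℝ} (hB : 0 ≤ B) (r s : ℝ) :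
    |truncate B r - truncate B s| ≤ |r - s| := by
  rw [truncate_eq hB, truncate_eq hB, max_comm, max_comm (-B)]
  exact (abs_max_sub_max_le_abs _ _ _).trans (abs_min_sub_min_le_max _ _ _ _ |>.trans (by simp))

theorem abs_truncate_sub_le {B y : ℝ} (hy : |y| ≤ B) (r : ℝ) : |truncate B r - y| ≤ |r - y| := by
  simpa [truncate_of_abs_le hy] using
    abs_truncate_sub_truncate_le ((abs_nonneg y).trans hy) r y

theorem truncate_truncate {W B : ℝ} (hW : 0 ≤ W) (hWB : W ≤ B) (r : ℝ) :
    truncate W (truncate B r) = truncate W r := by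
  rw [truncate_eq hW, truncate_eq (hW.trans hWB), truncate_eq hW]
  rcases le_total r B with h1 | h1
  · rw [min_eq_left h1]
    rcases le_total (-B) r with h2 | h2
    · rw [max_eq_right h2]
    · rw [max_eq_left h2, max_eq_left, max_eq_left]
      · exact (min_le_left _ _).trans (by linarith)
      · exact (min_le_left _ _).trans (by linarith)
  · rw [min_eq_right h1, max_eq_right (by linarith : -B ≤ B), min_eq_right hWB, min_eq_right (hWB.trans h1)]

theorem measurable_truncate {B : ℝ} (hB : 0 ≤ B) : Measurable (truncate B) := by
  have : truncate B = fun r => max (-B) (min r B) := funext (truncate_eq hB)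
  rw [this]
  fun_prop

end Truncate

/-! ### Covering numbers from the Vapnik–Chervonenkis dimension. -/

section VapnikChervonenkis

theorem sum_choose_le_pow (n d : ℕ) : ∑ k ∈ Finset.Iic d, n.choose k ≤ (n + 1) ^ d := by
  have e : Finset.Iic d = Finset.range (d + 1) := by ext; simp
  rw [add_pow, e]
  refine Finset.sum_le_sum fun k hk => ?_
  have h1 : 1 ≤ d.choose k := Nat.choose_pos (Nat.lt_succ_iff.1 (Finset.mem_range.1 hk))
  calc n.choose k ≤ n ^ k := Nat.choose_le_pow n k
    _ ≤ n ^ k * d.choose k := Nat.le_mul_of_pos_right _ h1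
    _ = _ := by simp

theorem exists_grid_between {B : ℝ} (hB : 0 < B) {K : ℕ} (hK : 0 < K) {u v : ℝ} (hu : -B ≤ u)
    (hv : v ≤ B) (huv : 2 * B / K < v - u) :
    ∃ l : Fin K, u < -B + 2 * B / K * (l + 1) ∧ -B + 2 * B / K * (l + 1) ≤ v := by
  have hK' : (0 : ℝ) < K := by exact_mod_cast hK
  set e := 2 * B / K with he
  have he0 : 0 < e := by positivity
  have heK : e * K = 2 * B := by rw [he]; field_simp
  set n := ⌊(u + B) / e⌋₊ with hn
  have h0 : 0 ≤ (u + B) / e := div_nonneg (by linarith) he0.le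
  have h1 : (n : ℝ) ≤ (u + B) / e := Nat.floor_le h0
  have h2 : (u + B) / e < n + 1 := Nat.lt_floor_add_one _
  rw [le_div_iff₀ he0] at h1
  rw [div_lt_iff₀ he0] at h2
  have h3 : n < K := by
    by_contra hc
    have : (K : ℝ) ≤ n := by exact_mod_cast not_lt.1 hc
    nlinarith
  exact ⟨⟨n, h3⟩, by simp only; linarith, by simp only; linarith⟩

/-- Only the traces of the subgraphs on the grid of sample points and K levels matter. Sauer–Shelah
bounds their number, and two functions with the same trace have truncated values at most one cell
width 2B/K apart; T takes one function per trace. -/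
theorem exists_truncate_cover {𝒳 ι : Type*} [Fintype ι] {Ψ : Set (𝒳 → ℝ)} {d : ℕ}
    (hd : functionVCDim Ψ ≤ d) {B : ℝ} (hB : 0 < B) (x : ι → 𝒳) {K : ℕ} (hK : 0 < K) :
    ∃ T : Finset (𝒳 → ℝ), ↑T ⊆ Ψ ∧ T.card ≤ (Fintype.card ι * K + 1) ^ d ∧
      ∀ ψ ∈ Ψ, ∃ ψ' ∈ T, ∀ i, |truncate B (ψ (x i)) - truncate B (ψ' (x i))| ≤ 2 * B / K := by
  classical
  set t : Fin K → ℝ := fun l => -B + 2 * B / K * (l + 1) with ht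
  set pt : ι × Fin K → 𝒳 × ℝ := fun q => (x q.1, t q.2) with hpt
  set pattern : (𝒳 → ℝ) → Finset (ι × Fin K) := fun ψ =>
    Finset.univ.filter fun q => t q.2 ≤ ψ (x q.1) with hpattern
  set 𝒜 : Finset (Finset (ι × Fin K)) :=
    Finset.univ.filter fun u => ∃ ψ ∈ Ψ, pattern ψ = u with h𝒜
  have hvc : 𝒜.vcDim ≤ d := by
    refine Finset.sup_le fun s hs => ?_
    rw [Finset.mem_shatterer] at hs
    -- Sample points may coincide. Indices over the same point lie in the same patterns, so a
    -- shattered index set maps injectively to points, and its image is shattered by the subgraphs.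
    have hinj : Set.InjOn pt (s : Set (ι × Fin K)) := by
      intro q hq q' hq' hqq
      obtain ⟨u, hu, hsu⟩ := hs (Finset.singleton_subset_iff.2 hq)
      obtain ⟨ψ, -, rfl⟩ := (Finset.mem_filter.1 hu).2
      have h1 : q ∈ pattern ψ := (Finset.mem_inter.1 (hsu ▸ Finset.mem_singleton_self q)).2
      have h2 : q' ∈ pattern ψ := by
        have e1 : x q.1 = x q'.1 := congrArg Prod.fst hqq
        have e2 : t q.2 = t q'.2 := congrArg Prod.snd hqq
        simp only [hpattern, Finset.mem_filter, Finset.mem_univ, true_and] at h1 ⊢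
        rwa [← e1, ← e2]
      have h3 : q' ∈ ({q} : Finset _) := hsu ▸ Finset.mem_inter.2 ⟨hq', h2⟩
      exact (Finset.mem_singleton.1 h3).symm
    have hsh : FamilyShatters {G : Set (𝒳 × ℝ) | ∃ f ∈ Ψ, G = {q | q.2 ≤ f q.1}} (s.image pt) := by
      intro U hU
      obtain ⟨u, hu, hsu⟩ := hs (Finset.filter_subset (fun q => pt q ∈ U) s)
      obtain ⟨ψ, hψ, rfl⟩ := (Finset.mem_filter.1 hu).2
      refine ⟨_, ⟨ψ, hψ, rfl⟩, ?_⟩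
      have key : ∀ q ∈ s, ((pt q).2 ≤ ψ (pt q).1 ↔ pt q ∈ U) := by
        intro q hq
        have := Finset.ext_iff.1 hsu q
        simpa [hpattern, hq] using this
      ext p
      constructor
      · rintro ⟨hp, hp'⟩
        obtain ⟨q, hq, rfl⟩ := Finset.mem_image.1 (Finset.mem_coe.1 hp)
        exact (key q hq).1 hp'
      · intro hp
        refine ⟨hU hp, ?_⟩
        obtain ⟨q, hq, rfl⟩ := Finset.mem_image.1 (Finset.mem_coe.1 (hU hp))
        exact (key q hq).2 hp
    have h1 : ((s.image pt).card : ℕ∞) ≤ functionVCDim Ψ :=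
      le_iSup₂ (f := fun (T : Finset (𝒳 × ℝ)) (_ : FamilyShatters _ T) => (T.card : ℕ∞)) _ hsh
    rw [Finset.card_image_of_injOn hinj] at h1
    exact_mod_cast h1.trans hd
  have hcard : 𝒜.card ≤ (Fintype.card ι * K + 1) ^ d := by
    calc 𝒜.card ≤ 𝒜.shatterer.card := Finset.card_le_card_shatterer 𝒜
      _ ≤ ∑ k ∈ Finset.Iic 𝒜.vcDim, (Fintype.card (ι × Fin K)).choose k :=
        Finset.card_shatterer_le_sum_vcDim
      _ ≤ (Fintype.card (ι × Fin K) + 1) ^ 𝒜.vcDim := sum_choose_le_pow _ _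
      _ ≤ (Fintype.card (ι × Fin K) + 1) ^ d := Nat.pow_le_pow_right (Nat.succ_pos _) hvc
      _ = _ := by simp
  have hch : ∀ u : Finset (ι × Fin K), ∃ ψ, u ∈ 𝒜 → ψ ∈ Ψ ∧ pattern ψ = u := by
    intro u
    by_cases hu : u ∈ 𝒜
    · obtain ⟨ψ, h1, h2⟩ := (Finset.mem_filter.1 hu).2
      exact ⟨ψ, fun _ => ⟨h1, h2⟩⟩
    · exact ⟨fun _ => 0, fun h => absurd h hu⟩
  choose c hc using hch
  refine ⟨𝒜.image c, ?_, Finset.card_image_le.trans hcard, ?_⟩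
  · intro ψ hψ
    obtain ⟨u, hu, rfl⟩ := Finset.mem_image.1 (Finset.mem_coe.1 hψ)
    exact (hc u hu).1
  · intro ψ hψ
    have hmem : pattern ψ ∈ 𝒜 := Finset.mem_filter.2 ⟨Finset.mem_univ _, ψ, hψ, rfl⟩
    refine ⟨c (pattern ψ), Finset.mem_image_of_mem _ hmem, fun i => ?_⟩
    have hpat := (hc _ hmem).2
    set ψ' := c (pattern ψ)
    have key : ∀ f g : 𝒳 → ℝ, pattern f = pattern g →
        truncate B (g (x i)) - truncate B (f (x i)) ≤ 2 * B / K := by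
      intro f g hfg
      by_contra! hcon
      have hf := abs_le.1 (abs_truncate_le hB.le (f (x i)))
      have hg := abs_le.1 (abs_truncate_le hB.le (g (x i)))
      obtain ⟨l, hl1, hl2⟩ := exists_grid_between hB hK hf.1 hg.2 hcon
      have h1 : (i, l) ∈ pattern g := by
        simp only [hpattern, Finset.mem_filter, Finset.mem_univ, true_and]
        -- As t l exceeds −B, the lower clip cannot be what brings the truncation of g up to t l;
        -- hence g itself reaches the level.
        have h3 : -B < t l := hf.1.trans_lt hl1
        rw [truncate_eq hB.le, le_max_iff, le_min_iff] at hl2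
        rcases hl2 with h | h
        · exact absurd h (not_le.2 h3)
        · exact h.1
      rw [← hfg] at h1
      simp only [hpattern, Finset.mem_filter, Finset.mem_univ, true_and] at h1
      rw [truncate_eq hB.le, max_lt_iff, min_lt_iff] at hl1
      rcases hl1.2 with h | h
      · exact absurd h1 (not_le.2 h)
      · exact absurd (hl2.trans hg.2) (not_le.2 h)
    rw [abs_le]
    constructor
    · linarith [key _ _ hpat.symm]
    · exact key _ _ hpat

/-- If f x < g x, the point (x, g x) is in one subgraph and not in the other, a shattered singleton.
This serves dimension 0, where an estimation term proportional to d leaves no room for the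
discretization error. -/
theorem subsingleton_of_functionVCDim_eq_zero {𝒳 : Type*} {Ψ : Set (𝒳 → ℝ)}
    (h : functionVCDim Ψ = 0) : Ψ.Subsingleton := by
  classical
  have key : ∀ f ∈ Ψ, ∀ g ∈ Ψ, ∀ x, ¬ f x < g x := by
    intro f hf g hg x hx
    have hsh : FamilyShatters {G : Set (𝒳 × ℝ) | ∃ f ∈ Ψ, G = {q | q.2 ≤ f q.1}} {(x, g x)} := by
      intro U hU
      rw [Finset.coe_singleton] at hU ⊢
      rcases Set.subset_singleton_iff_eq.1 hU with rfl | rfl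
      · refine ⟨_, ⟨f, hf, rfl⟩, ?_⟩
        rw [Set.singleton_inter_eq_empty]
        exact not_le.2 hx
      · refine ⟨_, ⟨g, hg, rfl⟩, ?_⟩
        rw [Set.inter_eq_left, Set.singleton_subset_iff]
        exact le_refl (g x)
    have h1 : ((({(x, g x)} : Finset (𝒳 × ℝ))).card : ℕ∞) ≤ functionVCDim Ψ :=
      le_iSup₂ (f := fun (T : Finset (𝒳 × ℝ)) (_ : FamilyShatters _ T) => (T.card : ℕ∞)) _ hsh
    rw [h] at h1
    simp at h1
  intro f hf g hg
  funext x
  exact le_antisymm (not_lt.1 (key g hg f hf x)) (not_lt.1 (key f hf g hg x))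

end VapnikChervonenkis

/-! ### Truncated least squares. -/

section Regression

theorem measurable_integral_kernel {𝒳 : Type*} [MeasurableSpace 𝒳] {κ : Kernel 𝒳 𝒳} {v : 𝒳 → ℝ}
    (hv : Measurable v) : Measurable fun x => ∫ y, v y ∂(κ x) :=
  (hv.stronglyMeasurable.integral_kernel (κ := κ)).measurable

variable {𝒳 : Type*} [MeasurableSpace 𝒳] {μ : Measure 𝒳} [IsProbabilityMeasure μ]
  {κ : Kernel 𝒳 𝒳} [IsMarkovKernel κ] {v m : 𝒳 → ℝ} {B : ℝ}

theorem abs_integral_le_of_abs_le {ρ : Measure 𝒳} [IsProbabilityMeasure ρ] (hvB : ∀ y, |v y| ≤ B) :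
    |∫ y, v y ∂ρ| ≤ B := by
  simpa using norm_integral_le_of_norm_le_const (μ := ρ) (f := v) (C := B)
    (Filter.Eventually.of_forall fun y => hvB y)

theorem integral_comp_fst_compProd {g : 𝒳 → ℝ} (hg : Measurable g) :
    ∫ e, g e.1 ∂(μ ⊗ₘ κ) = ∫ x, g x ∂μ := by
  conv_rhs => rw [← Measure.fst_compProd μ κ, Measure.fst]
  rw [integral_map measurable_fst.aemeasurable hg.aestronglyMeasurable]

theorem integrable_comp_fst_compProd {g : 𝒳 → ℝ} (hg : Measurable g) (hi : Integrable g μ) :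
    Integrable (fun e : 𝒳 × 𝒳 => g e.1) (μ ⊗ₘ κ) := by
  rw [← Measure.fst_compProd μ κ, Measure.fst] at hi
  exact (integrable_map_measure hg.aestronglyMeasurable measurable_fst.aemeasurable).1 hi

/-- Pythagoras: m is the conditional mean of v, so the cross term integrates to zero against κ.
Since g may be unbounded, the untruncated comparison function w is covered too. -/
theorem integrable_excess_and_integral_eq (hv : Measurable v) (hvB : ∀ y, |v y| ≤ B)
    (hm : ∀ x, m x = ∫ y, v y ∂(κ x)) {g : 𝒳 → ℝ} (hg : Measurable g)
    (hgm : Integrable (fun x => (g x - m x) ^ 2) μ) :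
    Integrable (fun e : 𝒳 × 𝒳 => (g e.1 - v e.2) ^ 2 - (m e.1 - v e.2) ^ 2) (μ ⊗ₘ κ) ∧
    ∫ e, ((g e.1 - v e.2) ^ 2 - (m e.1 - v e.2) ^ 2) ∂(μ ⊗ₘ κ) = ∫ x, (g x - m x) ^ 2 ∂μ := by
  have hmm : Measurable m := by
    rw [funext hm]; exact measurable_integral_kernel hv
  have hmB : ∀ x, |m x| ≤ B := fun x => by rw [hm]; exact abs_integral_le_of_abs_le hvB
  have hB : ∀ x : 𝒳, 0 ≤ B := fun x => (abs_nonneg _).trans (hmB x)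
  have h1 : Integrable (fun e : 𝒳 × 𝒳 => (g e.1 - m e.1) ^ 2) (μ ⊗ₘ κ) :=
    integrable_comp_fst_compProd (g := fun x => (g x - m x) ^ 2) (by fun_prop) hgm
  have h2 : Integrable (fun e : 𝒳 × 𝒳 => 2 * (g e.1 - m e.1) * (m e.1 - v e.2)) (μ ⊗ₘ κ) := by
    refine Integrable.mono' ((h1.add (integrable_const 1)).mul_const (2 * B))
      (by fun_prop) (Filter.Eventually.of_forall fun e => ?_)
    simp only [Pi.add_apply]
    rw [Real.norm_eq_abs, abs_mul, abs_mul, abs_two]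
    have a1 : |m e.1 - v e.2| ≤ 2 * B := (abs_sub _ _).trans (by linarith [hmB e.1, hvB e.2])
    have a2 : 2 * |g e.1 - m e.1| ≤ (g e.1 - m e.1) ^ 2 + 1 := by
      nlinarith [sq_nonneg (|g e.1 - m e.1| - 1), sq_abs (g e.1 - m e.1)]
    exact mul_le_mul a2 a1 (abs_nonneg _) (by positivity)
  have e1 : ∀ e : 𝒳 × 𝒳, (g e.1 - v e.2) ^ 2 - (m e.1 - v e.2) ^ 2 =
      (g e.1 - m e.1) ^ 2 + 2 * (g e.1 - m e.1) * (m e.1 - v e.2) := fun e => by ring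
  simp_rw [e1]
  refine ⟨h1.add h2, ?_⟩
  rw [integral_add h1 h2, integral_comp_fst_compProd (g := fun x => (g x - m x) ^ 2) (by fun_prop),
    Measure.integral_compProd h2]
  have h3 : ∀ x, ∫ y, 2 * (g x - m x) * (m x - v y) ∂(κ x) = 0 := by
    intro x
    rw [integral_const_mul, integral_sub (integrable_const _) (integrable_of_abs_le hv hvB), ← hm]
    simp
  simp [h3]

theorem log_cover_card_le {M : ℕ} (hM : 0 < M) (d : ℕ) :
    Real.log ((((M + M) * M + 1) ^ d : ℕ) : ℝ) ≤ d * (2 * (1 + Real.log M)) := by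
  have hM' : (1 : ℝ) ≤ M := by exact_mod_cast hM
  push_cast
  rw [Real.log_pow]
  gcongr
  calc Real.log ((M + M) * M + 1) ≤ Real.log (3 * (M : ℝ) ^ 2) :=
        Real.log_le_log (by positivity) (by nlinarith)
    _ = Real.log 3 + 2 * Real.log M := by
        rw [Real.log_mul (by norm_num) (by positivity), Real.log_pow]; norm_num
    _ ≤ _ := by
        have := Real.log_le_sub_one_of_pos (show (0 : ℝ) < 3 by norm_num)
        linarith

theorem abs_excess_sub_le {B a b y η : ℝ} (ha : |a| ≤ B) (hb : |b| ≤ B) (hy : |y| ≤ B)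
    (h : |a - b| ≤ η) : |(a - y) ^ 2 - (b - y) ^ 2| ≤ η * (4 * B) := by
  have e : (a - y) ^ 2 - (b - y) ^ 2 = (a - b) * (a + b - 2 * y) := by ring
  have := abs_le.1 ha; have := abs_le.1 hb; have := abs_le.1 hy
  rw [e, abs_mul]
  refine mul_le_mul h ?_ (abs_nonneg _) ((abs_nonneg _).trans h)
  rw [abs_le]; constructor <;> linarith

theorem abs_excess_le {B a b y : ℝ} (ha : |a| ≤ B) (hb : |b| ≤ B) (hy : |y| ≤ B) :
    |(a - y) ^ 2 - (b - y) ^ 2| ≤ 16 * B ^ 2 := by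
  refine (abs_excess_sub_le ha hb hy (η := 2 * B) ?_).trans ?_
  · exact (abs_sub _ _).trans (by linarith)
  · nlinarith [sq_nonneg B]

/-- The excess loss, with respect to `m`, of the truncation of `ψ` as a predictor of `v`. -/
noncomputable def excessLoss {𝒳 : Type*} (B : ℝ) (v m ψ : 𝒳 → ℝ) (e : 𝒳 × 𝒳) : ℝ :=
  (truncate B (ψ e.1) - v e.2) ^ 2 - (m e.1 - v e.2) ^ 2

theorem abs_excessLoss_le {𝒳 : Type*} {B : ℝ} {v m : 𝒳 → ℝ} (hB : 0 ≤ B) (hvB : ∀ y, |v y| ≤ B)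
    (hmB : ∀ x, |m x| ≤ B) (ψ : 𝒳 → ℝ) (e : 𝒳 × 𝒳) : |excessLoss B v m ψ e| ≤ 16 * B ^ 2 :=
  abs_excess_le (abs_truncate_le hB _) (hmB _) (hvB _)

/-- The Bernstein condition: the loss difference is (a − b)(a + b − 2y) with second factor at most
4B in absolute value, and the integral on the right is the mean of the excess loss. -/
theorem integral_excessLoss_sq_le (hv : Measurable v) (hB : 0 ≤ B)
    (hvB : ∀ y, |v y| ≤ B) (hmm : Measurable m) (hmB : ∀ x, |m x| ≤ B) {ψ : 𝒳 → ℝ}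
    (hψ : Measurable ψ) :
    ∫ e, excessLoss B v m ψ e ^ 2 ∂(μ ⊗ₘ κ) ≤
      16 * B ^ 2 * ∫ x, (truncate B (ψ x) - m x) ^ 2 ∂μ := by
  have hT := measurable_truncate hB
  have hTB := abs_truncate_le hB
  have hm2 : Measurable fun x => (truncate B (ψ x) - m x) ^ 2 := by fun_prop
  have hS : Measurable (excessLoss B v m ψ) := by unfold excessLoss; fun_prop
  have hi : Integrable (fun x => (truncate B (ψ x) - m x) ^ 2) μ := by
    refine integrable_of_abs_le (C := (2 * B) ^ 2) hm2 fun x => ?_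
    rw [abs_pow]
    exact pow_le_pow_left₀ (abs_nonneg _)
      ((abs_sub _ _).trans (by linarith [hTB (ψ x), hmB x])) 2
  rw [← integral_comp_fst_compProd (κ := κ) hm2, ← integral_const_mul]
  refine integral_mono (integrable_of_abs_le (C := (16 * B ^ 2) ^ 2) (hS.pow_const 2) fun e => ?_)
    ((integrable_comp_fst_compProd hm2 hi).const_mul _) fun e => ?_
  · rw [abs_pow]
    exact pow_le_pow_left₀ (abs_nonneg _) (abs_excessLoss_le hB hvB hmB ψ e) 2
  · have h1 := abs_excess_sub_le (hTB (ψ e.1)) (hmB e.1) (hvB e.2) le_rfl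
    have h2 := pow_le_pow_left₀ (abs_nonneg _) h1 2
    rw [sq_abs, mul_pow, sq_abs] at h2
    simp only [excessLoss]
    linarith

theorem exists_excessLoss_cover {𝒳 : Type*} {B : ℝ} {v : 𝒳 → ℝ} (m : 𝒳 → ℝ) (hB : 0 < B)
    (hvB : ∀ y, |v y| ≤ B) {M : ℕ} (hM : 0 < M) {Ψ : Set (𝒳 → ℝ)} {d : ℕ}
    (hd : functionVCDim Ψ ≤ d) (ω : Fin M → (𝒳 × 𝒳) × (𝒳 × 𝒳)) :
    ∃ T : Finset (𝒳 → ℝ), (T.card : ℝ) ≤ ((((M + M) * M + 1) ^ d : ℕ) : ℝ) ∧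
      ∀ i ∈ Ψ, ∃ i' ∈ T, ∀ k,
        |excessLoss B v m i (ω k).1 - excessLoss B v m i' (ω k).1| ≤ 8 * B ^ 2 / M ∧
        |excessLoss B v m i (ω k).2 - excessLoss B v m i' (ω k).2| ≤ 8 * B ^ 2 / M := by
  have hTB := abs_truncate_le hB.le
  obtain ⟨T, -, hTc, hT⟩ := exists_truncate_cover hd hB
    (Sum.elim (fun k => (ω k).1.1) fun k => (ω k).2.1) hM
  rw [Fintype.card_sum, Fintype.card_fin] at hTc
  refine ⟨T, Nat.cast_le.2 hTc, fun ψ hψ => ?_⟩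
  obtain ⟨ψ', hψ', hc⟩ := hT ψ hψ
  refine ⟨ψ', hψ', fun k => ?_⟩
  have c1 := hc (Sum.inl k)
  have c2 := hc (Sum.inr k)
  simp only [Sum.elim_inl, Sum.elim_inr] at c1 c2
  have e : 8 * B ^ 2 / M = 2 * B / M * (4 * B) := by ring
  simp only [excessLoss, sub_sub_sub_cancel_right, e]
  exact ⟨abs_excess_sub_le (hTB _) (hTB _) (hvB _) c1,
    abs_excess_sub_le (hTB _) (hTB _) (hvB _) c2⟩

/-- The expected squared error of truncated least squares over a class of functions with finite
Vapnik-Chervonenkis dimension `d ≥ 1`. -/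
theorem integral_sq_truncate_leastSquares_le (hv : Measurable v) (hB : 0 < B)
    (hvB : ∀ y, |v y| ≤ B) (hm : ∀ x, m x = ∫ y, v y ∂(κ x)) {M : ℕ} (hM : 0 < M)
    {Ψ : Set (𝒳 → ℝ)} {d : ℕ} (hd : functionVCDim Ψ ≤ d) (hd0 : 0 < d)
    (f : (Fin M → 𝒳 × 𝒳) → 𝒳 → ℝ) (hf : Measurable fun q : (Fin M → 𝒳 × 𝒳) × 𝒳 => f q.1 q.2)
    (hfΨ : ∀ S, f S ∈ Ψ) {w : 𝒳 → ℝ} (hw : Measurable w)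
    (hmin : ∀ S, ∑ k, (v (S k).2 - f S (S k).1) ^ 2 ≤ ∑ k, (v (S k).2 - w (S k).1) ^ 2)
    (hwm : Integrable (fun x => (w x - m x) ^ 2) μ) :
    ∫ S, ∫ x, (truncate B (f S x) - m x) ^ 2 ∂μ ∂(Measure.pi fun _ : Fin M => μ ⊗ₘ κ) ≤
      448 * B ^ 2 * ((1 + Real.log M) / M) * d + 2 * ∫ x, (w x - m x) ^ 2 ∂μ := by
  have hM' : (1 : ℝ) ≤ M := by exact_mod_cast hM
  have hlog : 0 ≤ Real.log M := Real.log_nonneg hM'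
  have hmm : Measurable m := by
    rw [funext hm]; exact measurable_integral_kernel hv
  have hmB : ∀ x, |m x| ≤ B := fun x => by rw [hm]; exact abs_integral_le_of_abs_le hvB
  have hT := measurable_truncate hB.le
  have hTB := abs_truncate_le hB.le
  have hb := abs_excessLoss_le (m := m) hB.le hvB hmB
  have hfS : ∀ S, Measurable (f S) := fun S => hf.comp measurable_prodMk_left
  have hfh : Measurable fun q : (Fin M → 𝒳 × 𝒳) × (𝒳 × 𝒳) => excessLoss B v m (f q.1) q.2 := by
    have : Measurable fun q : (Fin M → 𝒳 × 𝒳) × (𝒳 × 𝒳) => f q.1 q.2.1 :=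
      hf.comp (f := fun q : (Fin M → 𝒳 × 𝒳) × (𝒳 × 𝒳) => (q.1, q.2.1)) (by fun_prop)
    simp only [excessLoss]
    fun_prop
  have hsqb : ∀ S x, |(truncate B (f S x) - m x) ^ 2| ≤ (2 * B) ^ 2 := fun S x => by
    rw [abs_pow]
    exact pow_le_pow_left₀ (abs_nonneg _)
      ((abs_sub _ _).trans (by linarith [hTB (f S x), hmB x])) 2
  have hsqi : ∀ S, Integrable (fun x => (truncate B (f S x) - m x) ^ 2) μ := fun S =>
    integrable_of_abs_le (by have := hfS S; fun_prop) (hsqb S)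
  have hexc : ∀ S, ∫ e, excessLoss B v m (f S) e ∂(μ ⊗ₘ κ) = ∫ x, (truncate B (f S x) - m x) ^ 2 ∂μ := fun S =>
    (integrable_excess_and_integral_eq (g := fun x => truncate B (f S x)) hv hvB hm
      (by have := hfS S; fun_prop) (hsqi S)).2
  have hvar : ∀ S, ∫ e, excessLoss B v m (f S) e ^ 2 ∂(μ ⊗ₘ κ) ≤
      16 * B ^ 2 * ∫ e, excessLoss B v m (f S) e ∂(μ ⊗ₘ κ) := fun S => by
    rw [hexc]
    exact integral_excessLoss_sq_le hv hB.le hvB hmm hmB (hfS S)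
  -- κ = 16B² serves both as uniform bound and as Bernstein constant. The net uses M levels at the
  -- 2M points of sample and ghost sample, so η = (2B/M)·4B = 8B²/M.
  have main := integral_excess_sub_empirical_le (μ ⊗ₘ κ) hM (excessLoss B v m) f hfh
    (by positivity) hb hvar Ψ hfΨ _ (exists_excessLoss_cover m hB hvB hM hd)
  simp_rw [hexc] at main
  have hAm : Measurable fun S : Fin M → 𝒳 × 𝒳 => ∫ x, (truncate B (f S x) - m x) ^ 2 ∂μ :=
    (Measurable.stronglyMeasurable (by fun_prop)).integral_prod_right'
      (f := fun q : (Fin M → 𝒳 × 𝒳) × 𝒳 => (truncate B (f q.1 q.2) - m q.2) ^ 2) |>.measurable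
  have hAi : Integrable (fun S : Fin M → 𝒳 × 𝒳 => ∫ x, (truncate B (f S x) - m x) ^ 2 ∂μ)
      (Measure.pi fun _ => μ ⊗ₘ κ) :=
    integrable_of_abs_le hAm fun S => abs_integral_le_of_abs_le (hsqb S)
  have hPi : Integrable (fun S : Fin M → 𝒳 × 𝒳 => (∑ k, excessLoss B v m (f S) (S k)) / M)
      (Measure.pi fun _ => μ ⊗ₘ κ) :=
    (integrable_finsetSum _ fun k _ => integrable_of_abs_le
      (hfh.comp (f := fun S : Fin M → 𝒳 × 𝒳 => (S, S k)) (by fun_prop)) fun S => hb _ _).div_const _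
  obtain ⟨hqi, hq⟩ := integrable_excess_and_integral_eq (μ := μ) (κ := κ) hv hvB hm hw hwm
  set q : 𝒳 × 𝒳 → ℝ := fun e => (w e.1 - v e.2) ^ 2 - (m e.1 - v e.2) ^ 2 with hqdef
  have hqk : ∀ k : Fin M, Integrable (fun S : Fin M → 𝒳 × 𝒳 => q (S k))
      (Measure.pi fun _ => μ ⊗ₘ κ) := fun k =>
    (measurePreserving_eval (fun _ : Fin M => μ ⊗ₘ κ) k).integrable_comp_of_integrable hqi
  -- Truncation at B brings f S closer to the responses, so it does not raise the empirical loss;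
  -- minimality then compares with the fixed function w.
  have hP : ∫ S, (∑ k, excessLoss B v m (f S) (S k)) / M ∂(Measure.pi fun _ : Fin M => μ ⊗ₘ κ) ≤
      ∫ x, (w x - m x) ^ 2 ∂μ := by
    have h1 : ∫ S : Fin M → 𝒳 × 𝒳, (∑ k, q (S k)) / M ∂(Measure.pi fun _ => μ ⊗ₘ κ) =
        ∫ x, (w x - m x) ^ 2 ∂μ := by
      rw [integral_div, integral_finsetSum _ fun k _ => hqk k]
      have h2 : ∀ k : Fin M, ∫ S : Fin M → 𝒳 × 𝒳, q (S k) ∂(Measure.pi fun _ => μ ⊗ₘ κ) =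
          ∫ x, (w x - m x) ^ 2 ∂μ := fun k =>
        ((measurePreserving_eval (fun _ : Fin M => μ ⊗ₘ κ) k).hasLaw.integral_comp
          hqi.aestronglyMeasurable).trans hq
      simp_rw [h2]
      simp only [Finset.sum_const, Finset.card_univ, Fintype.card_fin, nsmul_eq_mul]
      field_simp
    rw [← h1]
    refine integral_mono hPi ((integrable_finsetSum _ fun k _ => hqk k).div_const _) fun S => ?_
    refine div_le_div_of_nonneg_right ?_ (by positivity)
    simp only [excessLoss, hqdef, Finset.sum_sub_distrib]
    refine sub_le_sub_right ?_ _
    calc ∑ k, (truncate B (f S (S k).1) - v (S k).2) ^ 2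
        ≤ ∑ k, (v (S k).2 - f S (S k).1) ^ 2 := by
          refine Finset.sum_le_sum fun k _ => ?_
          rw [sub_sq_comm (v _)]
          exact sq_le_sq.2 (abs_truncate_sub_le (hvB _) _)
      _ ≤ _ := hmin S
      _ = _ := Finset.sum_congr rfl fun k _ => sub_sq_comm _ _
  rw [integral_sub hAi (hPi.const_mul 2), integral_const_mul] at main
  have hlogN := log_cover_card_le hM d
  have hd1 : (1 : ℝ) ≤ d := by exact_mod_cast hd0
  -- 448 = 400 + 48: (25/2)·16·2 from log N ≤ 2d(1 + log M), and 6·8 from the discretization,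
  -- absorbed because d ≥ 1.
  have hfin : 25 / 2 * (16 * B ^ 2) * Real.log ((((M + M) * M + 1) ^ d : ℕ) : ℝ) / M +
      6 * (8 * B ^ 2 / M) ≤ 448 * B ^ 2 * ((1 + Real.log M) / M) * d := by
    have h1 : 25 / 2 * (16 * B ^ 2) * Real.log ((((M + M) * M + 1) ^ d : ℕ) : ℝ) / M ≤
        25 / 2 * (16 * B ^ 2) * (d * (2 * (1 + Real.log M))) / M := by gcongr
    have h2 : 6 * (8 * B ^ 2 / M) ≤ 48 * B ^ 2 * ((1 + Real.log M) * d) / M := by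
      have : (1 : ℝ) ≤ (1 + Real.log M) * d := by nlinarith
      calc 6 * (8 * B ^ 2 / M) = 48 * B ^ 2 * 1 / M := by ring
        _ ≤ _ := by gcongr
    calc _ ≤ 25 / 2 * (16 * B ^ 2) * (d * (2 * (1 + Real.log M))) / M +
          48 * B ^ 2 * ((1 + Real.log M) * d) / M := add_le_add h1 h2
      _ = _ := by ring
  linarith

/-- In extended non-negative reals the case of infinite ‖w − m‖ is trivial, and the bound can be
integrated over the remaining samples. For d = 0 the estimator is w itself. -/
theorem lintegral_sq_truncate_leastSquares_le (hv : Measurable v) (hB : 0 < B)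
    (hvB : ∀ y, |v y| ≤ B) (hm : ∀ x, m x = ∫ y, v y ∂(κ x)) {M : ℕ} (hM : 0 < M)
    {Ψ : Set (𝒳 → ℝ)} {d : ℕ} (hd : functionVCDim Ψ ≤ d)
    (f : (Fin M → 𝒳 × 𝒳) → 𝒳 → ℝ) (hf : Measurable fun q : (Fin M → 𝒳 × 𝒳) × 𝒳 => f q.1 q.2)
    (hfΨ : ∀ S, f S ∈ Ψ) {w : 𝒳 → ℝ} (hw : Measurable w) (hwΨ : w ∈ Ψ)
    (hmin : ∀ S, ∑ k, (v (S k).2 - f S (S k).1) ^ 2 ≤ ∑ k, (v (S k).2 - w (S k).1) ^ 2) :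
    ∫⁻ S, ∫⁻ x, ENNReal.ofReal ((truncate B (f S x) - m x) ^ 2) ∂μ
        ∂(Measure.pi fun _ : Fin M => μ ⊗ₘ κ) ≤
      ENNReal.ofReal (448 * B ^ 2 * ((1 + Real.log M) / M) * d) +
        2 * ∫⁻ x, ENNReal.ofReal ((w x - m x) ^ 2) ∂μ := by
  have hM' : (1 : ℝ) ≤ M := by exact_mod_cast hM
  have hlog : 0 ≤ Real.log M := Real.log_nonneg hM'
  have hmm : Measurable m := by
    rw [funext hm]; exact measurable_integral_kernel hv
  have hmB : ∀ x, |m x| ≤ B := fun x => by rw [hm]; exact abs_integral_le_of_abs_le hvB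
  rcases Nat.eq_zero_or_pos d with rfl | hd0
  · have hsub := subsingleton_of_functionVCDim_eq_zero (le_antisymm (by simpa using hd) zero_le)
    calc _ ≤ ∫⁻ _S, ∫⁻ x, ENNReal.ofReal ((w x - m x) ^ 2) ∂μ
          ∂(Measure.pi fun _ : Fin M => μ ⊗ₘ κ) := by
          refine lintegral_mono fun S => lintegral_mono fun x => ENNReal.ofReal_le_ofReal ?_
          rw [hsub (hfΨ S) hwΨ]
          exact sq_le_sq.2 (abs_truncate_sub_le (hmB x) _)
      _ = ∫⁻ x, ENNReal.ofReal ((w x - m x) ^ 2) ∂μ := by simp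
      _ ≤ 2 * ∫⁻ x, ENNReal.ofReal ((w x - m x) ^ 2) ∂μ :=
          le_mul_of_one_le_left zero_le (by norm_num)
      _ ≤ _ := le_add_self
  by_cases htop : ∫⁻ x, ENNReal.ofReal ((w x - m x) ^ 2) ∂μ = ∞
  · simp [htop]
  have hwm : Integrable (fun x => (w x - m x) ^ 2) μ := by
    refine ⟨by fun_prop, ?_⟩
    rw [hasFiniteIntegral_iff_ofReal (Filter.Eventually.of_forall fun x => sq_nonneg _)]
    exact lt_top_iff_ne_top.2 htop
  have key := integral_sq_truncate_leastSquares_le (μ := μ) (κ := κ) hv hB hvB hm hM hd hd0 f hf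
    hfΨ hw hmin hwm
  have hT := measurable_truncate hB.le
  have hsqb : ∀ S x, |(truncate B (f S x) - m x) ^ 2| ≤ (2 * B) ^ 2 := fun S x => by
    rw [abs_pow]
    exact pow_le_pow_left₀ (abs_nonneg _)
      ((abs_sub _ _).trans (by linarith [abs_truncate_le hB.le (f S x), hmB x])) 2
  have hjm : Measurable fun q : (Fin M → 𝒳 × 𝒳) × 𝒳 => (truncate B (f q.1 q.2) - m q.2) ^ 2 := by
    fun_prop
  have h1 : ∀ S, ∫⁻ x, ENNReal.ofReal ((truncate B (f S x) - m x) ^ 2) ∂μ =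
      ENNReal.ofReal (∫ x, (truncate B (f S x) - m x) ^ 2 ∂μ) := fun S =>
    (ofReal_integral_eq_lintegral_ofReal
      (integrable_of_abs_le (hjm.comp measurable_prodMk_left) (hsqb S))
      (Filter.Eventually.of_forall fun x => sq_nonneg _)).symm
  simp_rw [h1]
  rw [← ofReal_integral_eq_lintegral_ofReal
      (integrable_of_abs_le hjm.stronglyMeasurable.integral_prod_right'.measurable
        fun S => abs_integral_le_of_abs_le (hsqb S))
      (Filter.Eventually.of_forall fun S => integral_nonneg fun x => sq_nonneg _),
    ← ofReal_integral_eq_lintegral_ofReal hwm (Filter.Eventually.of_forall fun x => sq_nonneg _)]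
  refine (ENNReal.ofReal_le_ofReal key).trans ?_
  rw [ENNReal.ofReal_add (by positivity)
    (mul_nonneg zero_le_two (integral_nonneg fun x => sq_nonneg _)),
    ENNReal.ofReal_mul zero_le_two]
  simp

end Regression

/-! ### Measurable maxima and selections over finite sets. -/

section FiniteValued

variable {α β : Type*} [MeasurableSpace α] [Fintype β]

theorem measurable_comp_of_fintype {Y : α → β} (hY : ∀ b, MeasurableSet {a | Y a = b})
    {G : β → α → ℝ} (hG : ∀ b, Measurable (G b)) : Measurable fun a => G (Y a) a := by
  classical
  have : (fun a => G (Y a) a) = fun a => ∑ b, {a | Y a = b}.indicator (G b) a := by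
    funext a
    rw [Finset.sum_eq_single (Y a)]
    · simp
    · intro b _ hb
      have hn : a ∉ {a | Y a = b} := fun h => hb (Eq.symm h)
      exact Set.indicator_of_notMem hn (G b)
    · simp
  rw [this]
  exact Finset.measurable_sum _ fun b _ => (hG b).indicator (hY b)

theorem integral_comp_of_fintype {μ : Measure α} {Y : α → β}
    (hY : ∀ b, MeasurableSet {a | Y a = b}) {G : β → α → ℝ} (hG : ∀ b, Integrable (G b) μ) :
    ∫ a, G (Y a) a ∂μ = ∑ b, ∫ a in {a | Y a = b}, G b a ∂μ := by
  classical
  have : (fun a => G (Y a) a) = fun a => ∑ b, {a | Y a = b}.indicator (G b) a := by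
    funext a
    rw [Finset.sum_eq_single (Y a)]
    · simp
    · intro b _ hb
      have hn : a ∉ {a | Y a = b} := fun h => hb (Eq.symm h)
      exact Set.indicator_of_notMem hn (G b)
    · simp
  rw [this, integral_finsetSum _ fun b _ => (hG b).indicator (hY b)]
  exact Finset.sum_congr rfl fun b _ => integral_indicator (hY b)

theorem bddAbove_image_of_finite {γ : Type*} [Finite γ] (F : γ → ℝ) (S : Set γ) :
    BddAbove (F '' S) := (Set.toFinite _).bddAbove

theorem measurable_sSup_image {F : β → α → ℝ} (hF : ∀ b, Measurable (F b)) {K : α → Set β}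
    (hK : ∀ b, MeasurableSet {a | b ∈ K a}) (hne : ∀ a, (K a).Nonempty) :
    Measurable fun a => sSup ((fun b => F b a) '' K a) := by
  refine measurable_of_Iic fun t => ?_
  have : (fun a => sSup ((fun b => F b a) '' K a)) ⁻¹' Set.Iic t =
      ⋂ b, ({a | b ∈ K a}ᶜ ∪ {a | F b a ≤ t}) := by
    ext a
    simp only [Set.mem_preimage, Set.mem_Iic, Set.mem_iInter, Set.mem_union, Set.mem_compl_iff,
      Set.mem_ofPred_eq]
    rw [csSup_le_iff (bddAbove_image_of_finite _ _) ((hne a).image _), Set.forall_mem_image]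
    exact forall_congr' fun b => by tauto
  rw [this]
  exact MeasurableSet.iInter fun b =>
    (hK b).compl.union (measurableSet_le (hF b) measurable_const)

/-- The set of maximizers is a measurable random subset of a finite type, so a fixed choice function
on subsets yields a measurable selection. -/
theorem exists_measurable_argmax {F : β → α → ℝ} (hF : ∀ b, Measurable (F b)) {K : α → Set β}
    (hK : ∀ b, MeasurableSet {a | b ∈ K a}) (hne : ∀ a, (K a).Nonempty) :
    ∃ sel : α → β, (∀ a, sel a ∈ K a) ∧ (∀ a, F (sel a) a = sSup ((fun b => F b a) '' K a)) ∧
      ∀ b, MeasurableSet {a | sel a = b} := by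
  classical
  set O : α → Set β := fun a => {b | b ∈ K a ∧ F b a = sSup ((fun b => F b a) '' K a)} with hO
  have hOne : ∀ a, (O a).Nonempty := by
    intro a
    obtain ⟨b, hb, hb'⟩ := ((hne a).image fun b => F b a).csSup_mem (Set.toFinite _)
    exact ⟨b, hb, hb'⟩
  have hOm : ∀ b, MeasurableSet {a | b ∈ O a} := fun b =>
    (hK b).inter (measurableSet_eq_fun (hF b) (measurable_sSup_image hF hK hne))
  rcases isEmpty_or_nonempty α with hα | ⟨⟨a₀⟩⟩
  · exact ⟨fun a => isEmptyElim a, fun a => isEmptyElim a, fun a => isEmptyElim a,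
      fun b => Set.Subsingleton.measurableSet fun a => isEmptyElim a⟩
  have hch : ∀ S : Set β, ∃ b : β, S.Nonempty → b ∈ S := by
    intro S
    by_cases hS : S.Nonempty
    · exact ⟨hS.some, fun _ => hS.some_mem⟩
    · exact ⟨(hne a₀).some, fun h => absurd h hS⟩
  choose c hc using hch
  refine ⟨fun a => c (O a), fun a => (hc _ (hOne a)).1, fun a => (hc _ (hOne a)).2, fun b => ?_⟩
  have : {a | c (O a) = b} = ⋃ S : Set β, ⋃ _ : c S = b, ⋂ b', {a | b' ∈ O a ↔ b' ∈ S} := by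
    ext a
    simp only [Set.mem_iUnion, Set.mem_iInter, Set.mem_ofPred_eq, exists_prop]
    constructor
    · intro h
      exact ⟨O a, h, fun _ => Iff.rfl⟩
    · rintro ⟨S, hS, h⟩
      rwa [Set.ext h]
  rw [this]
  refine MeasurableSet.iUnion fun S => MeasurableSet.iUnion fun _ => MeasurableSet.iInter fun b' => ?_
  by_cases hb' : b' ∈ S
  · simpa [hb'] using hOm b'
  · simp only [hb', iff_false]
    exact (hOm b').compl

end FiniteValued

/-! ### Integrated forms of the Markov property. -/

section Markov

variable {Ω 𝒳 : Type*} [mΩ : MeasurableSpace Ω] [MeasurableSpace 𝒳] {J : ℕ}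
  {F : Filtration ℕ mΩ} {X : ℕ → Ω → 𝒳} {κ : ℕ → Kernel 𝒳 𝒳} {j : ℕ} {P : Measure Ω}

/-- The event S is kept so that one can later localize on the events, known at time ℓ, where the
next control has a given value. -/
theorem IsMarkovFrom.map_restrict (hκ : ∀ j, IsMarkovKernel (κ j))
    (hX : ∀ ℓ ≤ J, Measurable[F ℓ] (X ℓ)) (h : IsMarkovFrom J F X κ j P) {ℓ : ℕ} (hj : j ≤ ℓ)
    (hℓ : ℓ < J) {S : Set Ω} (hS : MeasurableSet[F ℓ] S) {B : Set 𝒳} (hB : MeasurableSet B) :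
    (P.restrict S).map (X (ℓ + 1)) B = ∫⁻ x, κ ℓ x B ∂((P.restrict S).map (X ℓ)) := by
  have := h.1
  have hXm : ∀ ℓ ≤ J, Measurable (X ℓ) := fun ℓ hl => (hX ℓ hl).mono (F.le ℓ) le_rfl
  have hB' : MeasurableSet (X (ℓ + 1) ⁻¹' B) := hXm (ℓ + 1) hℓ hB
  have hi : Integrable ((X (ℓ + 1) ⁻¹' B).indicator fun _ => (1 : ℝ)) P :=
    (integrable_const 1).indicator hB'
  have h1 := setIntegral_condExp (F.le ℓ) hi hS
  have h2 : ∫ ω in S, (P⟦X (ℓ + 1) ⁻¹' B | F ℓ⟧) ω ∂P = ∫ ω in S, (κ ℓ (X ℓ ω)).real B ∂P :=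
    integral_congr_ae (ae_restrict_of_ae (h.2 ℓ hj hℓ B hB))
  rw [h2, integral_indicator hB', setIntegral_one_eq_measureReal] at h1
  rw [Measure.map_apply (hXm _ hℓ) hB, lintegral_map ((κ ℓ).measurable_coe hB) (hXm _ hℓ.le)]
  have h3 : ∫⁻ ω in S, κ ℓ (X ℓ ω) B ∂P = ENNReal.ofReal (∫ ω in S, (κ ℓ (X ℓ ω)).real B ∂P) := by
    rw [ofReal_integral_eq_lintegral_ofReal]
    · simp [Measure.real]
    · refine integrable_of_abs_le (C := 1)
        (((κ ℓ).measurable_coe hB).ennreal_toReal.comp (hXm _ hℓ.le)) fun ω => ?_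
      rw [abs_of_nonneg measureReal_nonneg]
      exact measureReal_le_one
    · exact Filter.Eventually.of_forall fun ω => measureReal_nonneg
  rw [h3, h1, ofReal_measureReal]

theorem IsMarkovFrom.setIntegral_succ (hκ : ∀ j, IsMarkovKernel (κ j))
    (hX : ∀ ℓ ≤ J, Measurable[F ℓ] (X ℓ)) (h : IsMarkovFrom J F X κ j P) {ℓ : ℕ} (hj : j ≤ ℓ)
    (hℓ : ℓ < J) {S : Set Ω} (hS : MeasurableSet[F ℓ] S) {g : 𝒳 → ℝ} (hg : Measurable g) {C : ℝ}
    (hgC : ∀ x, |g x| ≤ C) :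
    ∫ ω in S, g (X (ℓ + 1) ω) ∂P = ∫ ω in S, ∫ x', g x' ∂(κ ℓ (X ℓ ω)) ∂P := by
  have := h.1
  have hXm : ∀ ℓ ≤ J, Measurable (X ℓ) := fun ℓ hl => (hX ℓ hl).mono (F.le ℓ) le_rfl
  have e : (P.restrict S).map (X (ℓ + 1)) = (((P.restrict S).map (X ℓ)) ⊗ₘ κ ℓ).snd := by
    ext B hB
    rw [h.map_restrict hκ hX hj hℓ hS hB, Measure.snd_apply hB, ← Set.univ_prod,
      Measure.compProd_apply_prod .univ hB, setLIntegral_univ]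
  rw [← integral_map (hXm _ hℓ).aemeasurable hg.aestronglyMeasurable, e, Measure.snd,
    integral_map measurable_snd.aemeasurable hg.aestronglyMeasurable,
    Measure.integral_compProd (f := fun e : 𝒳 × 𝒳 => g e.2)
      (integrable_of_abs_le (hg.comp measurable_snd) fun e => hgC e.2),
    integral_map (hXm _ hℓ.le).aemeasurable (measurable_integral_kernel hg).aestronglyMeasurable]

theorem IsMarkovFrom.map_prodMk (hκ : ∀ j, IsMarkovKernel (κ j))
    (hX : ∀ ℓ ≤ J, Measurable[F ℓ] (X ℓ)) (h : IsMarkovFrom J F X κ j P) {ℓ : ℕ} (hj : j ≤ ℓ)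
    (hℓ : ℓ < J) : P.map (fun ω => (X ℓ ω, X (ℓ + 1) ω)) = P.map (X ℓ) ⊗ₘ κ ℓ := by
  have := h.1
  have hXm : ∀ ℓ ≤ J, Measurable (X ℓ) := fun ℓ hl => (hX ℓ hl).mono (F.le ℓ) le_rfl
  have m1 := hXm _ hℓ.le
  have m2 := hXm _ hℓ
  refine Measure.ext_prod fun {A B} hA hB => ?_
  have h1 := h.map_restrict hκ hX hj hℓ (hX ℓ hℓ.le hA) hB
  rw [Measure.compProd_apply_prod hA hB, Measure.map_apply (m1.prodMk m2) (hA.prod hB),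
    Measure.restrict_map m1 hA, ← h1, Measure.map_apply m2 hB, Measure.restrict_apply (m2 hB)]
  congr 1
  ext ω
  simp [and_comm]

end Markov

/-! ### The dynamic programming principle. -/

namespace ControlProblem

variable {Ω 𝒳 𝒦 ℒ : Type*} [mΩ : MeasurableSpace Ω] [MeasurableSpace 𝒳] {J : ℕ}

/-- The Bellman operator for the continuation values `C`. -/
noncomputable def bellman (Q : ControlProblem Ω 𝒳 𝒦 ℒ J) (j : ℕ) (C : ℒ → 𝒳 → ℝ)
    (y : ℒ) (x : 𝒳) : ℝ :=
  sSup ((fun a => Q.H j a y x + C (Q.φ (j + 1) a y) x) '' Q.K j y x)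

/-- The solution of the dynamic programming recursion at time `J - n`. -/
noncomputable def dpToGo (Q : ControlProblem Ω 𝒳 𝒦 ℒ J) : ℕ → ℒ → 𝒳 → ℝ
  | 0 => Q.bellman J fun _ _ => 0
  | n + 1 => Q.bellman (J - (n + 1)) fun z x => ∫ x', Q.dpToGo n z x' ∂(Q.κ (J - (n + 1)) x)

/-- The solution of the dynamic programming recursion at time `j`. -/
noncomputable def dpValue (Q : ControlProblem Ω 𝒳 𝒦 ℒ J) (j : ℕ) : ℒ → 𝒳 → ℝ := Q.dpToGo (J - j)

/-- The continuation values of the dynamic programming recursion. -/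
noncomputable def dpCont (Q : ControlProblem Ω 𝒳 𝒦 ℒ J) (j : ℕ) (z : ℒ) (x : 𝒳) : ℝ :=
  if j < J then ∫ x', Q.dpValue (j + 1) z x' ∂(Q.κ j x) else 0

theorem dpValue_eq_bellman (Q : ControlProblem Ω 𝒳 𝒦 ℒ J) {j : ℕ} (hj : j ≤ J) :
    Q.dpValue j = Q.bellman j (Q.dpCont j) := by
  rcases hj.lt_or_eq with h | rfl
  · have e : J - j = (J - (j + 1)) + 1 := by omega
    have e' : J - (J - (j + 1) + 1) = j := by omega
    unfold dpValue
    rw [e, dpToGo, e']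
    congr 1
    funext z x
    rw [dpCont, if_pos h, dpValue]
  · unfold dpValue
    rw [Nat.sub_self, dpToGo]
    congr 1
    funext z x
    rw [dpCont, if_neg (lt_irrefl _)]

theorem measurable_X (Q : ControlProblem Ω 𝒳 𝒦 ℒ J) {ℓ : ℕ} (h : ℓ ≤ J) : Measurable (Q.X ℓ) :=
  (Q.adapted ℓ h).mono (Q.F.le ℓ) le_rfl

theorem abs_sSup_image_sub_le {F G : 𝒦 → ℝ} [Finite 𝒦] {S : Set 𝒦} (hS : S.Nonempty) {c : ℝ}
    (h : ∀ a ∈ S, |F a - G a| ≤ c) : |sSup (F '' S) - sSup (G '' S)| ≤ c := by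
  have key : ∀ F G : 𝒦 → ℝ, (∀ a ∈ S, |F a - G a| ≤ c) → sSup (F '' S) - sSup (G '' S) ≤ c := by
    intro F G h
    rw [sub_le_iff_le_add, csSup_le_iff (bddAbove_image_of_finite _ _) (hS.image _),
      Set.forall_mem_image]
    intro a ha
    have h1 := le_csSup (bddAbove_image_of_finite G S) (Set.mem_image_of_mem G ha)
    linarith [(abs_le.1 (h a ha)).2]
  rw [abs_le]
  constructor
  · linarith [key G F fun a ha => by rw [abs_sub_comm]; exact h a ha]
  · exact key F G h

variable [Fintype 𝒦] (Q : ControlProblem Ω 𝒳 𝒦 ℒ J)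

theorem abs_bellman_sub_le {j : ℕ} (hj : j ≤ J) {C C' : ℒ → 𝒳 → ℝ} {x : 𝒳} {c : ℝ}
    (h : ∀ z, |C z x - C' z x| ≤ c) (y : ℒ) : |Q.bellman j C y x - Q.bellman j C' y x| ≤ c :=
  abs_sSup_image_sub_le (Q.nonempty_K j hj y x) fun a _ => by
    rw [add_sub_add_left_eq_sub]; exact h _

theorem abs_bellman_le {j : ℕ} (hj : j ≤ J) {C : ℒ → 𝒳 → ℝ} {x : 𝒳} {c C_H : ℝ}
    (hH : ∀ a y x, |Q.H j a y x| ≤ C_H) (h : ∀ z, |C z x| ≤ c) (y : ℒ) :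
    |Q.bellman j C y x| ≤ C_H + c := by
  obtain ⟨a, -, ha⟩ := ((Q.nonempty_K j hj y x).image
    fun a => Q.H j a y x + C (Q.φ (j + 1) a y) x).csSup_mem (Set.toFinite _)
  rw [bellman, ← ha]
  exact (abs_add_le _ _).trans (add_le_add (hH _ _ _) (h _))

theorem measurable_bellman {α : Type*} [MeasurableSpace α] {j : ℕ} (hj : j ≤ J)
    {C : α → ℒ → 𝒳 → ℝ} {ξ : α → 𝒳} (hξ : Measurable ξ)
    (hC : ∀ z, Measurable fun a => C a z (ξ a)) (y : ℒ) :
    Measurable fun a => Q.bellman j (C a) y (ξ a) :=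
  measurable_sSup_image (F := fun b a => Q.H j b y (ξ a) + C a (Q.φ (j + 1) b y) (ξ a))
    (K := fun a => Q.K j y (ξ a))
    (fun b => ((Q.measurable_H j hj b y).comp hξ).add (hC _))
    (fun b => hξ (Q.measurable_K j hj b y)) fun a => Q.nonempty_K j hj y (ξ a)

omit [Fintype 𝒦] in
theorem measurable_dpCont_of {j : ℕ} (h : j < J → ∀ z, Measurable (Q.dpValue (j + 1) z)) (z : ℒ) :
    Measurable (Q.dpCont j z) := by
  unfold dpCont
  split_ifs with hj
  · exact measurable_integral_kernel (h hj z)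
  · exact measurable_const

theorem measurable_dpValue {j : ℕ} (hj : j ≤ J) (y : ℒ) : Measurable (Q.dpValue j y) := by
  induction hn : J - j generalizing j y with
  | zero =>
    rw [Q.dpValue_eq_bellman hj]
    exact Q.measurable_bellman (C := fun _ => Q.dpCont j) hj measurable_id
      (Q.measurable_dpCont_of fun h => by omega) y
  | succ n ih =>
    rw [Q.dpValue_eq_bellman hj]
    exact Q.measurable_bellman (C := fun _ => Q.dpCont j) hj measurable_id
      (Q.measurable_dpCont_of fun h z => ih (j := j + 1) h z (by omega)) y

theorem measurable_dpCont (j : ℕ) (z : ℒ) : Measurable (Q.dpCont j z) :=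
  Q.measurable_dpCont_of (fun h => Q.measurable_dpValue h) z

omit [Fintype 𝒦] in
theorem abs_dpCont_le_of {j : ℕ} {c : ℝ} (hc : 0 ≤ c)
    (h : j < J → ∀ z x, |Q.dpValue (j + 1) z x| ≤ c) (z : ℒ) (x : 𝒳) : |Q.dpCont j z x| ≤ c := by
  have := Q.markovKernel j
  unfold dpCont
  split_ifs with hj
  · exact abs_integral_le_of_abs_le (h hj z)
  · simpa using hc

theorem abs_dpValue_le {C_H : ℝ} (hC : 0 ≤ C_H) (hH : ∀ j ≤ J, ∀ a y x, |Q.H j a y x| ≤ C_H) {j : ℕ}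
    (hj : j ≤ J) (y : ℒ) (x : 𝒳) : |Q.dpValue j y x| ≤ C_H + (J - j : ℕ) * C_H := by
  induction hn : J - j generalizing j y x with
  | zero =>
    rw [Q.dpValue_eq_bellman hj]
    exact Q.abs_bellman_le hj (hH j hj)
      (fun z => Q.abs_dpCont_le_of (by positivity) (fun h => by omega) z x) y
  | succ n ih =>
    rw [Q.dpValue_eq_bellman hj]
    refine Q.abs_bellman_le hj (hH j hj)
      (fun z => Q.abs_dpCont_le_of (by positivity) (fun h z x => ?_) z x) y
    refine (ih (j := j + 1) h z x (by omega)).trans (le_of_eq ?_)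
    push_cast; ring

theorem abs_dpCont_le {C_H : ℝ} (hC : 0 ≤ C_H) (hH : ∀ j ≤ J, ∀ a y x, |Q.H j a y x| ≤ C_H) (j : ℕ)
    (z : ℒ) (x : 𝒳) : |Q.dpCont j z x| ≤ J * C_H := by
  refine Q.abs_dpCont_le_of (by positivity) (fun h z x => ?_) z x
  refine (Q.abs_dpValue_le hC hH h z x).trans ?_
  have : ((J - (j + 1) : ℕ) : ℝ) + 1 ≤ J := by
    exact_mod_cast (by omega : J - (j + 1) + 1 ≤ J)
  nlinarith

section Policies

variable {A : ℕ → Ω → 𝒦} {j : ℕ} {y : ℒ}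

omit [Fintype 𝒦] in
theorem controlPath_of_le (Q : ControlProblem Ω 𝒳 𝒦 ℒ J) (a : ℕ → 𝒦) {j ℓ : ℕ} (h : ℓ ≤ j) (y : ℒ) :
    Q.controlPath a j y ℓ = y := by
  cases ℓ with
  | zero => rfl
  | succ ℓ => rw [controlPath, if_pos (by omega)]

omit [Fintype 𝒦] in
theorem controlPath_succ (Q : ControlProblem Ω 𝒳 𝒦 ℒ J) (a : ℕ → 𝒦) {j ℓ : ℕ} (h : j ≤ ℓ) (y : ℒ) :
    Q.controlPath a j y (ℓ + 1) = Q.φ (ℓ + 1) (a ℓ) (Q.controlPath a j y ℓ) := by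
  rw [controlPath, if_neg (by omega)]

omit mΩ in
theorem measurableSet_map₂_eq {m : MeasurableSpace Ω} [Fintype ℒ] {a : Ω → 𝒦} {b : Ω → ℒ}
    (ha : ∀ i, MeasurableSet[m] {ω | a ω = i}) (hb : ∀ i, MeasurableSet[m] {ω | b ω = i})
    (f : 𝒦 → ℒ → ℒ) (z : ℒ) : MeasurableSet[m] {ω | f (a ω) (b ω) = z} := by
  have : {ω | f (a ω) (b ω) = z} =
      ⋃ i, ⋃ k, ⋃ _ : f i k = z, {ω | a ω = i} ∩ {ω | b ω = k} := by
    ext ω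
    simp
  rw [this]
  exact MeasurableSet.iUnion fun i => MeasurableSet.iUnion fun k => MeasurableSet.iUnion fun _ =>
    (ha i).inter (hb k)

variable [Fintype ℒ]

theorem measurableSet_controlPath (hA : A ∈ Q.admissible j y) {ℓ : ℕ} (hj : j ≤ ℓ) (hℓ : ℓ ≤ J)
    (z : ℒ) : MeasurableSet[Q.F ℓ] {ω | Q.controlPath (fun i => A i ω) j y ℓ = z} := by
  induction ℓ, hj using Nat.le_induction generalizing z with
  | base =>
    simp_rw [Q.controlPath_of_le _ le_rfl]
    exact MeasurableSet.const _
  | succ ℓ hj ih =>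
    simp_rw [Q.controlPath_succ _ hj]
    have := measurableSet_map₂_eq (hA ℓ hj (by omega)).1 (ih (by omega)) (Q.φ (ℓ + 1)) z
    exact Q.F.mono (Nat.le_succ ℓ) _ this

theorem measurableSet_controlPath_succ (hA : A ∈ Q.admissible j y) {ℓ : ℕ} (hj : j ≤ ℓ)
    (hℓ : ℓ ≤ J) (z : ℒ) :
    MeasurableSet[Q.F ℓ] {ω | Q.controlPath (fun i => A i ω) j y (ℓ + 1) = z} := by
  simp_rw [Q.controlPath_succ _ hj]
  exact measurableSet_map₂_eq (hA ℓ hj hℓ).1 (Q.measurableSet_controlPath hA hj hℓ) _ z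

variable {C_H : ℝ}

theorem measurable_cashFlow (hA : A ∈ Q.admissible j y) {ℓ : ℕ} (hj : j ≤ ℓ) (hℓ : ℓ ≤ J) :
    Measurable fun ω =>
      Q.H ℓ (A ℓ ω) (Q.controlPath (fun i => A i ω) j y ℓ) (Q.X ℓ ω) :=
  measurable_comp_of_fintype (fun a => Q.F.le ℓ _ ((hA ℓ hj hℓ).1 a)) fun a =>
    measurable_comp_of_fintype (fun z => Q.F.le ℓ _ (Q.measurableSet_controlPath hA hj hℓ z))
      fun z => (Q.measurable_H ℓ hℓ a z).comp (Q.measurable_X hℓ)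

/-- The next control is already known at time ℓ, so one splits along its finitely many values and
applies the Markov property on each event. -/
theorem integral_dpCont_eq (hC : 0 ≤ C_H) (hH : ∀ j ≤ J, ∀ a y x, |Q.H j a y x| ≤ C_H)
    (hA : A ∈ Q.admissible j y) {P : Measure Ω} (hP : IsMarkovFrom J Q.F Q.X Q.κ j P) {ℓ : ℕ}
    (hj : j ≤ ℓ) (hℓ : ℓ < J) :
    ∫ ω, Q.dpCont ℓ (Q.controlPath (fun i => A i ω) j y (ℓ + 1)) (Q.X ℓ ω) ∂P =
      ∫ ω, Q.dpValue (ℓ + 1) (Q.controlPath (fun i => A i ω) j y (ℓ + 1)) (Q.X (ℓ + 1) ω) ∂P := by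
  have := hP.1
  have hm := fun z => Q.F.le ℓ _ (Q.measurableSet_controlPath_succ hA hj hℓ.le z)
  rw [integral_comp_of_fintype (G := fun z ω => Q.dpCont ℓ z (Q.X ℓ ω)) hm fun z =>
      integrable_of_abs_le ((Q.measurable_dpCont ℓ z).comp (Q.measurable_X hℓ.le)) fun ω =>
        Q.abs_dpCont_le hC hH ℓ z _,
    integral_comp_of_fintype (G := fun z ω => Q.dpValue (ℓ + 1) z (Q.X (ℓ + 1) ω)) hm fun z =>
      integrable_of_abs_le ((Q.measurable_dpValue hℓ z).comp (Q.measurable_X hℓ)) fun ω =>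
        Q.abs_dpValue_le hC hH hℓ z _]
  refine Finset.sum_congr rfl fun z _ => ?_
  rw [hP.setIntegral_succ Q.markovKernel Q.adapted hj hℓ
    (Q.measurableSet_controlPath_succ hA hj hℓ.le z) (Q.measurable_dpValue hℓ z)
    (Q.abs_dpValue_le hC hH hℓ z)]
  simp only [dpCont, if_pos hℓ]

/-- The expected reward of a policy in terms of the losses against the dynamic programming
recursion. -/
theorem integral_sum_cashFlow_eq (hC : 0 ≤ C_H) (hH : ∀ j ≤ J, ∀ a y x, |Q.H j a y x| ≤ C_H)
    (hA : A ∈ Q.admissible j y) {P : Measure Ω} (hP : IsMarkovFrom J Q.F Q.X Q.κ j P) {k : ℕ}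
    (hj : j ≤ k) (hk : k ≤ J) :
    ∫ ω, ∑ ℓ ∈ Finset.Icc k J,
        Q.H ℓ (A ℓ ω) (Q.controlPath (fun i => A i ω) j y ℓ) (Q.X ℓ ω) ∂P =
      ∫ ω, Q.dpValue k (Q.controlPath (fun i => A i ω) j y k) (Q.X k ω) ∂P -
      ∑ ℓ ∈ Finset.Icc k J, ∫ ω, (Q.dpValue ℓ (Q.controlPath (fun i => A i ω) j y ℓ) (Q.X ℓ ω) -
        (Q.H ℓ (A ℓ ω) (Q.controlPath (fun i => A i ω) j y ℓ) (Q.X ℓ ω) +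
          Q.dpCont ℓ (Q.controlPath (fun i => A i ω) j y (ℓ + 1)) (Q.X ℓ ω))) ∂P := by
  have := hP.1
  have hHi : ∀ ℓ, j ≤ ℓ → ℓ ≤ J → Integrable (fun ω =>
      Q.H ℓ (A ℓ ω) (Q.controlPath (fun i => A i ω) j y ℓ) (Q.X ℓ ω)) P := fun ℓ h1 h2 =>
    integrable_of_abs_le (Q.measurable_cashFlow hA h1 h2) fun ω => hH ℓ h2 _ _ _
  have hVi : ∀ ℓ, j ≤ ℓ → ℓ ≤ J → Integrable (fun ω =>
      Q.dpValue ℓ (Q.controlPath (fun i => A i ω) j y ℓ) (Q.X ℓ ω)) P := fun ℓ h1 h2 =>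
    integrable_of_abs_le (measurable_comp_of_fintype
      (fun z => Q.F.le ℓ _ (Q.measurableSet_controlPath hA h1 h2 z))
      fun z => (Q.measurable_dpValue h2 z).comp (Q.measurable_X h2))
      fun ω => Q.abs_dpValue_le hC hH h2 _ _
  have hCi : ∀ ℓ, j ≤ ℓ → ℓ ≤ J → Integrable (fun ω =>
      Q.dpCont ℓ (Q.controlPath (fun i => A i ω) j y (ℓ + 1)) (Q.X ℓ ω)) P := fun ℓ h1 h2 =>
    integrable_of_abs_le (measurable_comp_of_fintype
      (fun z => Q.F.le ℓ _ (Q.measurableSet_controlPath_succ hA h1 h2 z))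
      fun z => (Q.measurable_dpCont ℓ z).comp (Q.measurable_X h2))
      fun ω => Q.abs_dpCont_le hC hH _ _ _
  have hsplit : ∀ ℓ, j ≤ ℓ → ℓ ≤ J →
      ∫ ω, (Q.dpValue ℓ (Q.controlPath (fun i => A i ω) j y ℓ) (Q.X ℓ ω) -
        (Q.H ℓ (A ℓ ω) (Q.controlPath (fun i => A i ω) j y ℓ) (Q.X ℓ ω) +
          Q.dpCont ℓ (Q.controlPath (fun i => A i ω) j y (ℓ + 1)) (Q.X ℓ ω))) ∂P =
      ∫ ω, Q.dpValue ℓ (Q.controlPath (fun i => A i ω) j y ℓ) (Q.X ℓ ω) ∂P -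
      (∫ ω, Q.H ℓ (A ℓ ω) (Q.controlPath (fun i => A i ω) j y ℓ) (Q.X ℓ ω) ∂P +
        ∫ ω, Q.dpCont ℓ (Q.controlPath (fun i => A i ω) j y (ℓ + 1)) (Q.X ℓ ω) ∂P) := by
    intro ℓ h1 h2
    rw [← integral_add (hHi ℓ h1 h2) (hCi ℓ h1 h2)]
    exact integral_sub (hVi ℓ h1 h2) ((hHi ℓ h1 h2).add (hCi ℓ h1 h2))
  rw [integral_finsetSum _ fun ℓ hℓ =>
    hHi ℓ (hj.trans (Finset.mem_Icc.1 hℓ).1) (Finset.mem_Icc.1 hℓ).2]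
  -- Telescoping: in expectation the continuation term of time k cancels the value at time k + 1. At
  -- k = J the default `dpCont` = 0 closes the sum.
  induction hn : J - k generalizing k with
  | zero =>
    obtain rfl : k = J := by omega
    rw [Finset.Icc_self, Finset.sum_singleton, Finset.sum_singleton, hsplit k hj le_rfl]
    simp [dpCont]
  | succ n ih =>
    rw [← Finset.insert_Icc_add_one_left_eq_Icc hk, Finset.sum_insert (by simp),
      Finset.sum_insert (by simp), ih (by omega) (by omega) (by omega), hsplit k hj hk,
      Q.integral_dpCont_eq hC hH hA hP hj (by omega)]
    ring

omit [Fintype ℒ] in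
theorem integral_dpValue_start (hj : j ≤ J) (y : ℒ) (x : 𝒳) :
    ∫ ω, Q.dpValue j y (Q.X j ω) ∂(Q.Pcond j x) = Q.dpValue j y x := by
  have hm := Q.measurable_dpValue hj y
  rw [← integral_map (Q.measurable_X hj).aemeasurable hm.aestronglyMeasurable,
    Q.start_cond j hj x, integral_dirac' _ _ hm.stronglyMeasurable]

theorem exists_optimal_policy (hj : j ≤ J) (y : ℒ) :
    ∃ A ∈ Q.admissible j y, ∀ ℓ, j ≤ ℓ → ℓ ≤ J → ∀ ω,
      Q.dpValue ℓ (Q.controlPath (fun i => A i ω) j y ℓ) (Q.X ℓ ω) =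
        Q.H ℓ (A ℓ ω) (Q.controlPath (fun i => A i ω) j y ℓ) (Q.X ℓ ω) +
          Q.dpCont ℓ (Q.controlPath (fun i => A i ω) j y (ℓ + 1)) (Q.X ℓ ω) := by
  have hsel : ∀ ℓ z, ∃ sel : 𝒳 → 𝒦, ℓ ≤ J → (∀ x, sel x ∈ Q.K ℓ z x) ∧
      (∀ x, Q.H ℓ (sel x) z x + Q.dpCont ℓ (Q.φ (ℓ + 1) (sel x) z) x = Q.dpValue ℓ z x) ∧
      ∀ b, MeasurableSet {x | sel x = b} := by
    intro ℓ z
    by_cases hℓ : ℓ ≤ J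
    · obtain ⟨sel, h1, h2, h3⟩ := exists_measurable_argmax
        (F := fun a x => Q.H ℓ a z x + Q.dpCont ℓ (Q.φ (ℓ + 1) a z) x)
        (fun a => (Q.measurable_H ℓ hℓ a z).add (Q.measurable_dpCont ℓ _))
        (fun a => Q.measurable_K ℓ hℓ a z) (Q.nonempty_K ℓ hℓ z)
      refine ⟨sel, fun _ => ⟨h1, fun x => (h2 x).trans ?_, h3⟩⟩
      rw [Q.dpValue_eq_bellman hℓ, bellman]
    · have : Nonempty (𝒳 → 𝒦) := ⟨fun x => (Q.nonempty_K j hj y x).some⟩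
      exact ⟨this.some, fun h => absurd h hℓ⟩
  choose sel hsel using hsel
  -- Policy and control path determine each other; the path is built first, by recursion through the
  -- selectors, and the actions are read off from it.
  let Y : ℕ → Ω → ℒ := fun ℓ ω => Nat.rec y
    (fun i z => if i < j then y else Q.φ (i + 1) (sel i z (Q.X i ω)) z) ℓ
  let A : ℕ → Ω → 𝒦 := fun ℓ ω => sel ℓ (Y ℓ ω) (Q.X ℓ ω)
  have hY : ∀ ℓ ω, Q.controlPath (fun i => A i ω) j y ℓ = Y ℓ ω := by
    intro ℓ ω
    induction ℓ with
    | zero => rfl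
    | succ ℓ ih => rw [controlPath, ih]
  have hAm : ∀ ℓ ≤ J, (∀ z, MeasurableSet[Q.F ℓ] {ω | Y ℓ ω = z}) →
      ∀ a, MeasurableSet[Q.F ℓ] {ω | A ℓ ω = a} := by
    intro ℓ hℓ h a
    have : {ω | A ℓ ω = a} = ⋃ z, {ω | Y ℓ ω = z} ∩ Q.X ℓ ⁻¹' {x | sel ℓ z x = a} := by
      ext ω
      simp [A]
    rw [this]
    exact MeasurableSet.iUnion fun z => (h z).inter (Q.adapted ℓ hℓ ((hsel ℓ z hℓ).2.2 a))
  have hYm : ∀ ℓ ≤ J, ∀ z, MeasurableSet[Q.F ℓ] {ω | Y ℓ ω = z} := by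
    intro ℓ
    induction ℓ with
    | zero => exact fun _ z => MeasurableSet.const (y = z)
    | succ ℓ ih =>
      intro hℓ z
      by_cases h : ℓ < j
      · have e : ∀ ω, Y (ℓ + 1) ω = y := fun ω => if_pos h
        simp_rw [e]
        exact MeasurableSet.const _
      · have e : ∀ ω, Y (ℓ + 1) ω = Q.φ (ℓ + 1) (A ℓ ω) (Y ℓ ω) := fun ω => if_neg h
        simp_rw [e]
        exact Q.F.mono (Nat.le_succ ℓ) _ (measurableSet_map₂_eq
          (hAm ℓ (by omega) (ih (by omega))) (ih (by omega)) _ z)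
  refine ⟨A, fun ℓ h1 h2 => ⟨hAm ℓ h2 (hYm ℓ h2), fun ω => ?_⟩, fun ℓ h1 h2 ω => ?_⟩
  · rw [hY]
    exact (hsel ℓ _ h2).1 _
  · rw [Q.controlPath_succ _ h1, hY]
    exact ((hsel ℓ _ h2).2.1 _).symm

/-- The dynamic programming principle. -/
theorem value_eq_dpValue (hC : 0 ≤ C_H) (hH : ∀ j ≤ J, ∀ a y x, |Q.H j a y x| ≤ C_H) (hj : j ≤ J)
    (y : ℒ) (x : 𝒳) : Q.value j y x = Q.dpValue j y x := by
  have hP := Q.markov_cond j hj x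
  have hstart : ∀ A : ℕ → Ω → 𝒦,
      ∫ ω, Q.dpValue j (Q.controlPath (fun i => A i ω) j y j) (Q.X j ω) ∂(Q.Pcond j x) =
        Q.dpValue j y x := by
    intro A
    simp_rw [Q.controlPath_of_le _ le_rfl]
    exact Q.integral_dpValue_start hj y x
  refine IsGreatest.csSup_eq ⟨?_, ?_⟩
  · obtain ⟨A, hA, hopt⟩ := Q.exists_optimal_policy hj y
    refine ⟨A, hA, ?_⟩
    simp only
    rw [Q.integral_sum_cashFlow_eq hC hH hA hP le_rfl hj, hstart, Finset.sum_eq_zero, sub_zero]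
    intro ℓ hℓ
    rw [Finset.mem_Icc] at hℓ
    simp [hopt ℓ hℓ.1 hℓ.2]
  · rintro _ ⟨A, hA, rfl⟩
    simp only
    rw [Q.integral_sum_cashFlow_eq hC hH hA hP le_rfl hj, hstart]
    -- Each loss is non-negative because `dpValue` maximizes over the admissible actions, of which A
    -- takes one.
    refine sub_le_self _ (Finset.sum_nonneg fun ℓ hℓ => integral_nonneg fun ω => ?_)
    rw [Finset.mem_Icc] at hℓ
    rw [Pi.zero_apply, sub_nonneg, Q.controlPath_succ _ hℓ.1, Q.dpValue_eq_bellman hℓ.2]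
    exact le_csSup (bddAbove_image_of_finite _ _)
      (Set.mem_image_of_mem (fun a => Q.H ℓ a _ (Q.X ℓ ω) + Q.dpCont ℓ (Q.φ (ℓ + 1) a _) (Q.X ℓ ω))
        ((hA ℓ hℓ.1 hℓ.2).2 ω))

end Policies

end ControlProblem

/-! ### Resampling, L² contraction and elementary inequalities. -/

section Auxiliary

/-- Redrawing one coordinate from its own law preserves the product measure; this replaces
conditioning on the other sample blocks. -/
theorem lintegral_pi_update {ι : Type*} [Fintype ι] [DecidableEq ι] {E : ι → Type*}
    [∀ i, MeasurableSpace (E i)] (μ : ∀ i, Measure (E i)) [∀ i, IsProbabilityMeasure (μ i)] (j : ι)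
    {G : (∀ i, E i) → ℝ≥0∞} (hG : Measurable G) :
    ∫⁻ s, ∫⁻ t, G (Function.update s j t) ∂(μ j) ∂(Measure.pi μ) = ∫⁻ s, G s ∂(Measure.pi μ) := by
  have hm : Measurable fun q : (∀ i, E i) × E j => Function.update q.1 j q.2 := by
    refine measurable_pi_iff.2 fun i => ?_
    by_cases h : i = j
    · subst h
      simpa using measurable_snd
    · simp only [Function.update_of_ne h]
      fun_prop
  have hmap : ((Measure.pi μ).prod (μ j)).map (fun q => Function.update q.1 j q.2) =
      Measure.pi μ := by
    refine (Measure.pi_eq fun B hB => ?_).symm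
    rw [Measure.map_apply hm (MeasurableSet.univ_pi hB)]
    have e : (fun q : (∀ i, E i) × E j => Function.update q.1 j q.2) ⁻¹' Set.univ.pi B =
        (Set.univ.pi (Function.update B j Set.univ)) ×ˢ B j := by
      ext ⟨s, t⟩
      simp only [Set.mem_preimage, Set.mem_pi, Set.mem_univ, true_implies, Set.mem_prod]
      constructor
      · intro h
        refine ⟨fun i => ?_, by simpa using h j⟩
        by_cases hi : i = j
        · subst hi; simp
        · simpa [Function.update_of_ne hi] using h i
      · rintro ⟨h1, h2⟩ i
        by_cases hi : i = j
        · subst hi; simpa using h2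
        · simpa [Function.update_of_ne hi] using h1 i
    rw [e, Measure.prod_prod, Measure.pi_pi,
      ← Finset.prod_erase_mul Finset.univ (fun i => μ i (B i)) (Finset.mem_univ j),
      ← Finset.prod_erase_mul Finset.univ (fun i => μ i (Function.update B j Set.univ i))
        (Finset.mem_univ j)]
    simp only [Function.update_self, measure_univ, mul_one]
    congr 1
    refine Finset.prod_congr rfl fun i hi => ?_
    rw [Function.update_of_ne (Finset.ne_of_mem_erase hi)]
  conv_rhs => rw [← hmap]
  rw [lintegral_map hG hm]
  exact (lintegral_prod (fun q : (∀ i, E i) × E j => G (Function.update q.1 j q.2))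
    (hG.comp hm).aemeasurable).symm

theorem eLpNorm_two_sq_eq_lintegral_ofReal {α : Type*} [MeasurableSpace α] (ρ : Measure α)
    (g : α → ℝ) : eLpNorm g 2 ρ ^ 2 = ∫⁻ a, ENNReal.ofReal (g a ^ 2) ∂ρ := by
  rw [eLpNorm_eq_lintegral_rpow_enorm_toReal (by norm_num) (by norm_num), ← ENNReal.rpow_natCast,
    ← ENNReal.rpow_mul]
  norm_num
  refine lintegral_congr fun a => ?_
  rw [← sq_abs, ENNReal.ofReal_pow (abs_nonneg _), ← Real.enorm_eq_ofReal_abs]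

theorem sq_integral_le_integral_sq {α : Type*} [MeasurableSpace α] {ρ : Measure α}
    [IsProbabilityMeasure ρ] {g : α → ℝ} (hg : Measurable g) {C : ℝ} (hC : ∀ a, |g a| ≤ C) :
    (∫ a, g a ∂ρ) ^ 2 ≤ ∫ a, g a ^ 2 ∂ρ := by
  set c := ∫ a, g a ∂ρ with hc
  have i1 : Integrable g ρ := integrable_of_abs_le hg hC
  have i2 : Integrable (fun a => g a ^ 2) ρ :=
    integrable_of_abs_le (C := C ^ 2) (hg.pow_const 2) fun a => by
      rw [abs_pow]; exact pow_le_pow_left₀ (abs_nonneg _) (hC a) 2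
  have h : ∫ a, (2 * c * g a - c ^ 2) ∂ρ ≤ ∫ a, g a ^ 2 ∂ρ :=
    integral_mono ((i1.const_mul _).sub (integrable_const _)) i2 fun a => by
      simp only; nlinarith [sq_nonneg (g a - c)]
  rw [integral_sub (i1.const_mul _) (integrable_const _), integral_const_mul, ← hc] at h
  simp only [integral_const, probReal_univ, one_smul] at h
  nlinarith

/-- A Markov kernel acting on one coordinate contracts the `L²`-norm. -/
theorem eLpNorm_integral_kernel_le {𝒳 S : Type*} [MeasurableSpace 𝒳] [MeasurableSpace S]
    {μ : Measure 𝒳} [IsProbabilityMeasure μ] {κ : Kernel 𝒳 𝒳} [IsMarkovKernel κ] {π : Measure S}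
    [IsProbabilityMeasure π] {g : 𝒳 × S → ℝ} (hg : Measurable g) {C : ℝ} (hC : ∀ q, |g q| ≤ C) :
    eLpNorm (fun q : 𝒳 × S => ∫ x', g (x', q.2) ∂(κ q.1)) 2 (μ.prod π) ≤
      eLpNorm g 2 ((μ ⊗ₘ κ).snd.prod π) := by
  have hgm : Measurable fun q : 𝒳 × S => ∫ x', g (x', q.2) ∂(κ q.1) := by
    have : Measurable fun r : (𝒳 × S) × 𝒳 => g (r.2, r.1.2) := hg.comp (by fun_prop)
    exact (this.stronglyMeasurable.integral_kernel_prod_right'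
      (κ := κ.comap Prod.fst measurable_fst)).measurable
  refine (ENNReal.pow_le_pow_left_iff (two_ne_zero)).1 ?_
  rw [eLpNorm_two_sq_eq_lintegral_ofReal, eLpNorm_two_sq_eq_lintegral_ofReal,
    lintegral_prod_symm' _ (by fun_prop), lintegral_prod_symm' _ (by fun_prop)]
  refine lintegral_mono fun s => ?_
  have hs : Measurable fun x => ENNReal.ofReal (g (x, s) ^ 2) := by fun_prop
  rw [Measure.snd, lintegral_map hs measurable_snd,
    Measure.lintegral_compProd (f := fun e : 𝒳 × 𝒳 => ENNReal.ofReal (g (e.2, s) ^ 2))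
      (hs.comp measurable_snd)]
  refine lintegral_mono fun x => ?_
  have hgs : Measurable fun x' => g (x', s) := by fun_prop
  refine (ENNReal.ofReal_le_ofReal (sq_integral_le_integral_sq hgs fun a => hC _)).trans ?_
  rw [ofReal_integral_eq_lintegral_ofReal
    (integrable_of_abs_le (C := C ^ 2) (hgs.pow_const 2) fun a => by
      rw [abs_pow]; exact pow_le_pow_left₀ (abs_nonneg _) (hC _) 2)
    (Filter.Eventually.of_forall fun a => sq_nonneg _)]

/-- The infimum need not be attained, so w is taken within ε/2 of the bound δ, which costs √2·ε/2 ≤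
ε; the rest is √(A + 2x²) ≤ √A + √2·x. -/
theorem le_ofReal_sqrt_add_of_sq_le {e : ℝ≥0∞} {ι : Type*} {Ψ : Set ι} {f : ι → ℝ≥0∞} {A δ : ℝ}
    (hA : 0 ≤ A) (hδ : 0 ≤ δ) (h : ∀ w ∈ Ψ, e ^ 2 ≤ ENNReal.ofReal A + 2 * f w ^ 2)
    (hf : ⨅ w ∈ Ψ, f w ≤ ENNReal.ofReal δ) :
    e ≤ ENNReal.ofReal (Real.sqrt A + Real.sqrt 2 * δ) := by
  refine ENNReal.le_of_forall_pos_le_add fun ε hε _ => ?_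
  have hε' : (0 : ℝ) < ε := hε
  set η : ℝ := ε / 2 with hη
  have hη0 : 0 < η := by positivity
  have hlt : ⨅ w ∈ Ψ, f w < ENNReal.ofReal (δ + η) :=
    hf.trans_lt ((ENNReal.ofReal_lt_ofReal_iff (by positivity)).2 (by linarith))
  obtain ⟨w, hw⟩ := iInf_lt_iff.1 hlt
  obtain ⟨hwΨ, hw⟩ := iInf_lt_iff.1 hw
  have h2 : Real.sqrt 2 ≤ 2 := by
    rw [Real.sqrt_le_left (by norm_num)]; norm_num
  have h3 : e ^ 2 ≤ ENNReal.ofReal (Real.sqrt A + Real.sqrt 2 * (δ + η)) ^ 2 := by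
    calc e ^ 2 ≤ ENNReal.ofReal A + 2 * f w ^ 2 := h w hwΨ
      _ ≤ ENNReal.ofReal A + 2 * ENNReal.ofReal (δ + η) ^ 2 := by gcongr
      _ = ENNReal.ofReal (A + 2 * (δ + η) ^ 2) := by
          rw [ENNReal.ofReal_add hA (by positivity), ENNReal.ofReal_mul (by norm_num),
            ENNReal.ofReal_pow (by positivity)]
          simp
      _ ≤ ENNReal.ofReal ((Real.sqrt A + Real.sqrt 2 * (δ + η)) ^ 2) := by
          refine ENNReal.ofReal_le_ofReal ?_
          have e1 := Real.sq_sqrt hA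
          have e2 := Real.sq_sqrt (show (0 : ℝ) ≤ 2 by norm_num)
          have : 0 ≤ Real.sqrt A * (Real.sqrt 2 * (δ + η)) := by positivity
          nlinarith
      _ = _ := ENNReal.ofReal_pow (by positivity) 2
  refine ((ENNReal.pow_le_pow_left_iff two_ne_zero).1 h3).trans ?_
  have e3 : (ε : ℝ≥0∞) = ENNReal.ofReal ε := by simp
  rw [e3, ← ENNReal.ofReal_add (by positivity) hε'.le]
  refine ENNReal.ofReal_le_ofReal ?_
  nlinarith

/-- Bernoulli's inequality. The error recursion produces only the linear factor n·L, which is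
enlarged here to L + L² + … + Lⁿ. -/
theorem mul_le_geom_factor {L : ℝ} (hL : 2 ≤ L) (n : ℕ) :
    n * L ≤ (L ^ (n + 1) - L) / (L - 1) := by
  rw [le_div_iff₀ (by linarith)]
  have := one_add_mul_le_pow (a := L - 1) (by linarith) n
  rw [pow_succ]
  have e : 1 + (L - 1) = L := by ring
  rw [e] at this
  nlinarith

theorem pow_le_geom_factor {L : ℝ} (hL : 2 ≤ L) {n : ℕ} (hn : 0 < n) :
    L ^ n ≤ (L ^ (n + 1) - L) / (L - 1) ∧ (L ^ (n + 1) - L) / (L - 1) ≤ 2 * L ^ n := by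
  have h1 : L ≤ L ^ n := le_self_pow₀ (by linarith) hn.ne'
  have h2 : 0 < L ^ n := by positivity
  rw [le_div_iff₀ (by linarith), div_le_iff₀ (by linarith), pow_succ]
  constructor <;> nlinarith

end Auxiliary

/-! ### Error propagation for the regression scheme. -/

namespace ControlProblem

variable {Ω 𝒳 𝒦 ℒ : Type*} [MeasurableSpace Ω] [MeasurableSpace 𝒳] [Fintype 𝒦] {J M : ℕ}
  (Q : ControlProblem Ω 𝒳 𝒦 ℒ J) {C_H W : ℝ} {Ψ : ℕ → Set (𝒳 → ℝ)}
  {p : ℕ → ℒ → Sample 𝒳 J M → 𝒳 → ℝ}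

omit [Fintype 𝒦] in
theorem estValue_eq_bellman (W : ℝ) (p : ℕ → ℒ → Sample 𝒳 J M → 𝒳 → ℝ) (j : ℕ) (y : ℒ)
    (s : Sample 𝒳 J M) (x : 𝒳) : Q.estValue W p j y s x =
      Q.bellman j (fun z x => if j < J then truncate W (p j z s x) else 0) y x := rfl

theorem measurable_estValue (hp : Q.IsEmpiricalProjection W Ψ p) (hW : 0 ≤ W) {j : ℕ} (hj : j ≤ J)
    (y : ℒ) : Measurable fun q : Sample 𝒳 J M × 𝒳 => Q.estValue W p j y q.1 q.2 := by
  refine Q.measurable_bellman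
    (C := fun (q : Sample 𝒳 J M × 𝒳) z x => if j < J then truncate W (p j z q.1 x) else 0)
    hj measurable_snd (fun z => ?_) y
  split_ifs with h
  · exact (measurable_truncate hW).comp (hp.measurable ⟨j, h⟩ z)
  · exact measurable_const

theorem measurable_estValue_right (hp : Q.IsEmpiricalProjection W Ψ p) (hW : 0 ≤ W) {j : ℕ}
    (hj : j ≤ J) (y : ℒ) (s : Sample 𝒳 J M) : Measurable (Q.estValue W p j y s) :=
  (Q.measurable_estValue hp hW hj y).comp measurable_prodMk_left

theorem abs_estValue_le (hW : 0 ≤ W) (hH : ∀ j ≤ J, ∀ a y x, |Q.H j a y x| ≤ C_H) {j : ℕ}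
    (hj : j ≤ J) (y : ℒ) (s : Sample 𝒳 J M) (x : 𝒳) : |Q.estValue W p j y s x| ≤ C_H + W := by
  rw [estValue_eq_bellman]
  refine Q.abs_bellman_le hj (hH j hj) (fun z => ?_) y
  split_ifs with h
  · exact abs_truncate_le hW _
  · simpa using hW

-- Used at time j + 1: the target of the regression at time j does not see block j, so it stays
-- fixed while that block is redrawn.
omit [Fintype 𝒦] in
theorem estValue_congr (hp : Q.IsEmpiricalProjection W Ψ p) {j : ℕ} {s s' : Sample 𝒳 J M}
    (h : ∀ k : Fin J, j ≤ k → s k = s' k) (y : ℒ) :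
    Q.estValue W p j y s = Q.estValue W p j y s' := by
  funext x
  rw [estValue_eq_bellman, estValue_eq_bellman]
  by_cases hj : j < J
  · have : ∀ z, p j z s = p j z s' := fun z => hp.nonanticipating ⟨j, hj⟩ z s s' h
    simp only [this]
  · simp only [hj, if_false]

/-- Under `Pcond j x` the state at time j is distributed as the point mass at x, so one Markov step
is integration against `κ j x`. -/
theorem contTilde_eq (hp : Q.IsEmpiricalProjection W Ψ p) (hW : 0 ≤ W)
    (hH : ∀ j ≤ J, ∀ a y x, |Q.H j a y x| ≤ C_H) {j : ℕ} (hj : j < J) (z : ℒ)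
    (s : Sample 𝒳 J M) (x : 𝒳) :
    Q.contTilde W p j z s x = ∫ x', Q.estValue W p (j + 1) z s x' ∂(Q.κ j x) := by
  have hg := Q.measurable_estValue_right hp hW hj z s
  have h := (Q.markov_cond j hj.le x).setIntegral_succ Q.markovKernel Q.adapted le_rfl hj
    MeasurableSet.univ hg (Q.abs_estValue_le hW hH hj z s)
  have hm := measurable_integral_kernel (κ := Q.κ j) hg
  rw [setIntegral_univ, setIntegral_univ,
    ← integral_map (φ := Q.X j) (f := fun x => ∫ x', Q.estValue W p (j + 1) z s x' ∂(Q.κ j x))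
      (Q.measurable_X hj.le).aemeasurable hm.aestronglyMeasurable, Q.start_cond j hj.le x,
    integral_dirac' _ _ hm.stronglyMeasurable] at h
  exact h

theorem measurable_contTilde (hp : Q.IsEmpiricalProjection W Ψ p) (hW : 0 ≤ W)
    (hH : ∀ j ≤ J, ∀ a y x, |Q.H j a y x| ≤ C_H) {j : ℕ} (hj : j < J) (z : ℒ) :
    Measurable fun q : 𝒳 × Sample 𝒳 J M => Q.contTilde W p j z q.2 q.1 := by
  have := Q.markovKernel j
  simp_rw [Q.contTilde_eq hp hW hH hj]
  have h : Measurable fun r : (𝒳 × Sample 𝒳 J M) × 𝒳 => Q.estValue W p (j + 1) z r.1.2 r.2 :=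
    (Q.measurable_estValue hp hW hj z).comp
      (f := fun r : (𝒳 × Sample 𝒳 J M) × 𝒳 => (r.1.2, r.2)) (by fun_prop)
  exact (h.stronglyMeasurable.integral_kernel_prod_right'
    (κ := (Q.κ j).comap Prod.fst measurable_fst)).measurable

omit [Fintype 𝒦] in
theorem isProbabilityMeasure_stateLaw {j : ℕ} (hj : j ≤ J) :
    IsProbabilityMeasure (Q.stateLaw j) :=
  have := Q.markov.1
  Measure.isProbabilityMeasure_map (Q.measurable_X hj).aemeasurable

omit [Fintype 𝒦] in
theorem map_pair_eq {j : ℕ} (hj : j < J) :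
    Q.P.map (fun ω => (Q.X j ω, Q.X (j + 1) ω)) = Q.stateLaw j ⊗ₘ Q.κ j :=
  Q.markov.map_prodMk Q.markovKernel Q.adapted (Nat.zero_le j) hj

omit [Fintype 𝒦] in
theorem stateLaw_succ {j : ℕ} (hj : j < J) :
    Q.stateLaw (j + 1) = (Q.stateLaw j ⊗ₘ Q.κ j).snd := by
  rw [← Q.map_pair_eq hj, Measure.snd_map_prodMk (Q.measurable_X hj.le), stateLaw]

omit [Fintype 𝒦] in
theorem isProbabilityMeasure_map_pair {j : ℕ} (hj : j < J) :
    IsProbabilityMeasure (Q.P.map fun ω => (Q.X j ω, Q.X (j + 1) ω)) :=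
  have := Q.markov.1
  Measure.isProbabilityMeasure_map
    ((Q.measurable_X hj.le).prodMk (Q.measurable_X hj)).aemeasurable

omit [Fintype 𝒦] in
theorem isProbabilityMeasure_sampleLaw (M : ℕ) : IsProbabilityMeasure (Q.sampleLaw M) := by
  have := fun j : Fin J => Q.isProbabilityMeasure_map_pair j.2
  unfold sampleLaw
  infer_instance

/-- The regression error at time `j`, for the control `z`. -/
theorem eLpNorm_sq_regression_le (hp : Q.IsEmpiricalProjection W Ψ p) (hW : 0 ≤ W)
    (hH : ∀ j ≤ J, ∀ a y x, |Q.H j a y x| ≤ C_H) {B : ℝ} (hB : 0 < B) (hCB : C_H + W ≤ B)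
    (hM : 0 < M) {j : ℕ} (hj : j < J) (hΨ : ∀ ψ ∈ Ψ j, Measurable ψ) {d : ℕ}
    (hd : functionVCDim (Ψ j) ≤ d) (z : ℒ) {w : 𝒳 → ℝ} (hw : w ∈ Ψ j) :
    eLpNorm (fun q : 𝒳 × Sample 𝒳 J M => truncate B (p j z q.2 q.1) - Q.contTilde W p j z q.2 q.1)
        2 ((Q.stateLaw j).prod (Q.sampleLaw M)) ^ 2 ≤
      ENNReal.ofReal (448 * B ^ 2 * ((1 + Real.log M) / M) * d) +
        2 * eLpNorm (fun q : 𝒳 × Sample 𝒳 J M => Q.contTilde W p j z q.2 q.1 - w q.1) 2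
          ((Q.stateLaw j).prod (Q.sampleLaw M)) ^ 2 := by
  have := Q.isProbabilityMeasure_stateLaw hj.le
  have := Q.isProbabilityMeasure_sampleLaw M
  have := Q.markovKernel j
  have := fun j : Fin J => Q.isProbabilityMeasure_map_pair j.2
  have hC := Q.measurable_contTilde hp hW hH hj z
  have hT := measurable_truncate hB.le
  have hpm : Measurable fun q : Sample 𝒳 J M × 𝒳 => p j z q.1 q.2 := hp.measurable ⟨j, hj⟩ z
  have hpm' : Measurable fun q : 𝒳 × Sample 𝒳 J M => p j z q.2 q.1 := hpm.comp measurable_swap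
  have hwm := hΨ w hw
  have m1 : Measurable fun q : 𝒳 × Sample 𝒳 J M => ENNReal.ofReal
      ((truncate B (p j z q.2 q.1) - Q.contTilde W p j z q.2 q.1) ^ 2) := by fun_prop
  have m2 : Measurable fun q : 𝒳 × Sample 𝒳 J M => ENNReal.ofReal
      ((Q.contTilde W p j z q.2 q.1 - w q.1) ^ 2) := by fun_prop
  rw [eLpNorm_two_sq_eq_lintegral_ofReal, eLpNorm_two_sq_eq_lintegral_ofReal,
    lintegral_prod_symm' _ m1, lintegral_prod_symm' _ m2]
  -- All blocks but j are frozen: what remains is least squares for a fixed function whose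
  -- regression function is C̃_j.
  have key : ∀ s : Sample 𝒳 J M,
      ∫⁻ t, ∫⁻ x, ENNReal.ofReal ((truncate B (p j z (Function.update s ⟨j, hj⟩ t) x) -
          Q.contTilde W p j z (Function.update s ⟨j, hj⟩ t) x) ^ 2) ∂(Q.stateLaw j)
        ∂(Measure.pi fun _ : Fin M => Q.P.map fun ω => (Q.X j ω, Q.X (j + 1) ω)) ≤
      ENNReal.ofReal (448 * B ^ 2 * ((1 + Real.log M) / M) * d) +
        2 * ∫⁻ x, ENNReal.ofReal ((Q.contTilde W p j z s x - w x) ^ 2) ∂(Q.stateLaw j) := by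
    intro s
    have hest : ∀ t, Q.estValue W p (j + 1) z (Function.update s ⟨j, hj⟩ t) =
        Q.estValue W p (j + 1) z s := fun t => by
      refine Q.estValue_congr hp (fun k hk => ?_) z
      refine Function.update_of_ne (fun h => ?_) _ _
      have : (k : ℕ) = j := congrArg Fin.val h
      omega
    have hcont : ∀ t, Q.contTilde W p j z (Function.update s ⟨j, hj⟩ t) =
        Q.contTilde W p j z s := fun t => by
      funext x
      rw [contTilde, hest, contTilde]
    simp_rw [hcont, sub_sq_comm (Q.contTilde W p j z s _) (w _)]
    rw [Q.map_pair_eq hj]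
    refine lintegral_sq_truncate_leastSquares_le (v := Q.estValue W p (j + 1) z s)
      (Q.measurable_estValue_right hp hW hj z s) hB
      (fun y => (Q.abs_estValue_le hW hH hj z s y).trans hCB)
      (fun x => Q.contTilde_eq hp hW hH hj z s x) hM hd
      (fun t => p j z (Function.update s ⟨j, hj⟩ t)) ?_ (fun t => hp.mem ⟨j, hj⟩ z _) hwm hw
      fun t => ?_
    · refine hpm.comp (f := fun q : (Fin M → 𝒳 × 𝒳) × 𝒳 => (Function.update s ⟨j, hj⟩ q.1, q.2))
        (Measurable.prodMk ?_ measurable_snd)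
      exact (measurable_update s).comp measurable_fst
    · have h := hp.minimal ⟨j, hj⟩ z (Function.update s ⟨j, hj⟩ t) w hw
      simpa only [Function.update_self, hest, sq_abs] using h
  calc _ = ∫⁻ s, ∫⁻ t, ∫⁻ x, ENNReal.ofReal ((truncate B (p j z (Function.update s ⟨j, hj⟩ t) x) -
          Q.contTilde W p j z (Function.update s ⟨j, hj⟩ t) x) ^ 2) ∂(Q.stateLaw j)
        ∂(Measure.pi fun _ : Fin M => Q.P.map fun ω => (Q.X j ω, Q.X (j + 1) ω))
        ∂(Q.sampleLaw M) :=
        (lintegral_pi_update (fun j : Fin J => Measure.pi fun _ : Fin M =>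
          Q.P.map fun ω => (Q.X j ω, Q.X (j + 1) ω)) ⟨j, hj⟩ m1.lintegral_prod_left').symm
    _ ≤ ∫⁻ s, (ENNReal.ofReal (448 * B ^ 2 * ((1 + Real.log M) / M) * d) +
        2 * ∫⁻ x, ENNReal.ofReal ((Q.contTilde W p j z s x - w x) ^ 2) ∂(Q.stateLaw j))
        ∂(Q.sampleLaw M) := lintegral_mono key
    _ = _ := by
        rw [lintegral_add_left measurable_const,
          lintegral_const_mul _ m2.lintegral_prod_left']
        simp

/-- The pointwise error of the estimated value functions, uniformly in the control. -/
noncomputable def estError (W : ℝ) (p : ℕ → ℒ → Sample 𝒳 J M → 𝒳 → ℝ) (j : ℕ)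
    (q : 𝒳 × Sample 𝒳 J M) : ℝ :=
  ⨆ z : ℒ, |Q.estValue W p j z q.2 q.1 - Q.dpValue j z q.1|

variable [Fintype ℒ]

omit [Fintype 𝒦] in
theorem le_estError (j : ℕ) (q : 𝒳 × Sample 𝒳 J M) (z : ℒ) :
    |Q.estValue W p j z q.2 q.1 - Q.dpValue j z q.1| ≤ Q.estError W p j q :=
  le_ciSup (f := fun z => |Q.estValue W p j z q.2 q.1 - Q.dpValue j z q.1|)
    (Set.finite_range _).bddAbove z

omit [Fintype 𝒦] [Fintype ℒ] in
theorem estError_nonneg (j : ℕ) (q : 𝒳 × Sample 𝒳 J M) : 0 ≤ Q.estError W p j q :=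
  Real.iSup_nonneg fun _ => abs_nonneg _

theorem measurable_estError (hp : Q.IsEmpiricalProjection W Ψ p) (hW : 0 ≤ W) {j : ℕ}
    (hj : j ≤ J) : Measurable (Q.estError W p j) := by
  refine Measurable.iSup fun z => ?_
  have h1 := (Q.measurable_estValue hp hW hj z).comp (measurable_swap (α := 𝒳))
  have h2 : Measurable fun q : 𝒳 × Sample 𝒳 J M => Q.dpValue j z q.1 :=
    (Q.measurable_dpValue hj z).comp measurable_fst
  exact (h1.sub h2).abs

omit [Fintype ℒ] in
theorem abs_estError_le [Nonempty ℒ] (hW : 0 ≤ W) (hC : 0 ≤ C_H)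
    (hH : ∀ j ≤ J, ∀ a y x, |Q.H j a y x| ≤ C_H) {j : ℕ} (hj : j ≤ J) (q : 𝒳 × Sample 𝒳 J M) :
    |Q.estError W p j q| ≤ C_H + W + (C_H + (J - j : ℕ) * C_H) := by
  rw [abs_of_nonneg (Q.estError_nonneg j q)]
  exact ciSup_le fun z => (abs_sub _ _).trans
    (add_le_add (Q.abs_estValue_le hW hH hj z _ _) (Q.abs_dpValue_le hC hH hj z _))

/-- The difference between T_W 𝒫 and the true continuation value is split at T_W C̃. As T_W = T_W ∘
T_B, the first part is a regression error; the second is a kernel average of the error at j + 1.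
Only the first is summed over the controls, so |ℒ| does not compound. -/
theorem estError_le [Nonempty ℒ] (hp : Q.IsEmpiricalProjection W Ψ p) (hC : 0 ≤ C_H)
    (hH : ∀ j ≤ J, ∀ a y x, |Q.H j a y x| ≤ C_H) (hW : W = J * C_H) {B : ℝ} (hWB : W ≤ B) {j : ℕ}
    (hj : j < J) (q : 𝒳 × Sample 𝒳 J M) :
    Q.estError W p j q ≤
      ∑ z, |truncate B (p j z q.2 q.1) - Q.contTilde W p j z q.2 q.1| +
        ∫ x', Q.estError W p (j + 1) (x', q.2) ∂(Q.κ j q.1) := by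
  have hW0 : 0 ≤ W := by rw [hW]; positivity
  have := Q.markovKernel j
  refine ciSup_le fun y => ?_
  rw [estValue_eq_bellman, Q.dpValue_eq_bellman hj.le]
  refine Q.abs_bellman_sub_le hj.le (fun z => ?_) y
  rw [if_pos hj]
  have h1 : |truncate W (p j z q.2 q.1) - truncate W (Q.contTilde W p j z q.2 q.1)| ≤
      ∑ z, |truncate B (p j z q.2 q.1) - Q.contTilde W p j z q.2 q.1| := by
    rw [← truncate_truncate hW0 hWB (p j z q.2 q.1)]
    exact (abs_truncate_sub_truncate_le hW0 _ _).trans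
      (Finset.single_le_sum
        (f := fun z => |truncate B (p j z q.2 q.1) - Q.contTilde W p j z q.2 q.1|)
        (fun z _ => abs_nonneg _) (Finset.mem_univ z))
  have h2 : |truncate W (Q.contTilde W p j z q.2 q.1) - Q.dpCont j z q.1| ≤
      ∫ x', Q.estError W p (j + 1) (x', q.2) ∂(Q.κ j q.1) := by
    have hb : |Q.dpCont j z q.1| ≤ W := hW ▸ Q.abs_dpCont_le hC hH j z q.1
    refine (abs_truncate_sub_le hb _).trans ?_
    rw [Q.contTilde_eq hp hW0 hH hj, dpCont, if_pos hj,
      ← integral_sub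
        (integrable_of_abs_le (Q.measurable_estValue_right hp hW0 hj z q.2)
          (Q.abs_estValue_le hW0 hH hj z q.2))
        (integrable_of_abs_le (Q.measurable_dpValue hj z) (Q.abs_dpValue_le hC hH hj z))]
    refine abs_integral_le_integral_abs.trans (integral_mono_of_nonneg
      (Filter.Eventually.of_forall fun x' => abs_nonneg _) ?_
      (Filter.Eventually.of_forall fun x' => Q.le_estError (j + 1) (x', q.2) z))
    exact integrable_of_abs_le
      ((Q.measurable_estError hp hW0 hj).comp measurable_prodMk_right)
      fun x' => Q.abs_estError_le hW0 hC hH hj _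
  exact (abs_sub_le _ _ _).trans (add_le_add h1 h2)

/-- Each time adds |ℒ|·e by Minkowski, and the inherited error is not amplified since κ_j carries
μ_j to μ_{j+1}. At time J the two recursions agree. -/
theorem eLpNorm_estError_le [Nonempty ℒ] (hp : Q.IsEmpiricalProjection W Ψ p) (hC : 0 ≤ C_H)
    (hH : ∀ j ≤ J, ∀ a y x, |Q.H j a y x| ≤ C_H) (hW : W = J * C_H) {B : ℝ} (hB : 0 ≤ B)
    (hWB : W ≤ B) {e : ℝ≥0∞}
    (he : ∀ j < J, ∀ z, eLpNorm (fun q : 𝒳 × Sample 𝒳 J M =>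
      truncate B (p j z q.2 q.1) - Q.contTilde W p j z q.2 q.1) 2
        ((Q.stateLaw j).prod (Q.sampleLaw M)) ≤ e) {j : ℕ} (hj : j ≤ J) :
    eLpNorm (Q.estError W p j) 2 ((Q.stateLaw j).prod (Q.sampleLaw M)) ≤
      (J - j : ℕ) * (Fintype.card ℒ * e) := by
  have hW0 : 0 ≤ W := by rw [hW]; positivity
  have := Q.isProbabilityMeasure_sampleLaw M
  induction hn : J - j generalizing j with
  | zero =>
    obtain rfl : j = J := by omega
    have : Q.estError W p j = fun _ => 0 := by
      funext q
      simp [estError, estValue_eq_bellman, Q.dpValue_eq_bellman, bellman, dpCont]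
    rw [this]
    simp
  | succ n ih =>
    have hj' : j < J := by omega
    have := Q.isProbabilityMeasure_stateLaw hj
    have := Q.markovKernel j
    have hTm : ∀ z, Measurable fun q : 𝒳 × Sample 𝒳 J M =>
        truncate B (p j z q.2 q.1) - Q.contTilde W p j z q.2 q.1 := fun z =>
      ((measurable_truncate hB).comp ((hp.measurable ⟨j, hj'⟩ z).comp measurable_swap)).sub
        (Q.measurable_contTilde hp hW0 hH hj' z)
    have hEm := Q.measurable_estError hp hW0 hj'
    have hIm : Measurable fun q : 𝒳 × Sample 𝒳 J M =>
        ∫ x', Q.estError W p (j + 1) (x', q.2) ∂(Q.κ j q.1) := by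
      have : Measurable fun r : (𝒳 × Sample 𝒳 J M) × 𝒳 => Q.estError W p (j + 1) (r.2, r.1.2) :=
        hEm.comp (by fun_prop)
      exact (this.stronglyMeasurable.integral_kernel_prod_right'
        (κ := (Q.κ j).comap Prod.fst measurable_fst)).measurable
    have h1 : eLpNorm (Q.estError W p j) 2 ((Q.stateLaw j).prod (Q.sampleLaw M)) ≤
        eLpNorm ((∑ z, fun q : 𝒳 × Sample 𝒳 J M =>
          |truncate B (p j z q.2 q.1) - Q.contTilde W p j z q.2 q.1|) +
          fun q => ∫ x', Q.estError W p (j + 1) (x', q.2) ∂(Q.κ j q.1)) 2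
          ((Q.stateLaw j).prod (Q.sampleLaw M)) := by
      refine eLpNorm_mono_real fun q => ?_
      rw [Real.norm_eq_abs, abs_of_nonneg (Q.estError_nonneg j q)]
      simpa using Q.estError_le hp hC hH hW hWB hj' q
    have h2 : eLpNorm (∑ z, fun q : 𝒳 × Sample 𝒳 J M =>
          |truncate B (p j z q.2 q.1) - Q.contTilde W p j z q.2 q.1|) 2
          ((Q.stateLaw j).prod (Q.sampleLaw M)) ≤ Fintype.card ℒ * e := by
      refine (eLpNorm_sum_le (fun z _ => (hTm z).abs.aestronglyMeasurable) one_le_two).trans ?_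
      calc _ ≤ ∑ _z : ℒ, e := Finset.sum_le_sum fun z _ => by
            refine le_trans (le_of_eq ?_) (he j hj' z)
            exact eLpNorm_norm (fun q : 𝒳 × Sample 𝒳 J M =>
              truncate B (p j z q.2 q.1) - Q.contTilde W p j z q.2 q.1)
        _ = _ := by simp
    have h3 : eLpNorm (fun q : 𝒳 × Sample 𝒳 J M =>
          ∫ x', Q.estError W p (j + 1) (x', q.2) ∂(Q.κ j q.1)) 2
          ((Q.stateLaw j).prod (Q.sampleLaw M)) ≤ n * (Fintype.card ℒ * e) := by
      refine (eLpNorm_integral_kernel_le hEm (Q.abs_estError_le hW0 hC hH hj')).trans ?_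
      rw [← Q.stateLaw_succ hj']
      exact ih hj' (by omega)
    refine h1.trans ((eLpNorm_add_le ?_ hIm.aestronglyMeasurable one_le_two).trans ?_)
    · rw [Finset.sum_fn]
      exact (Finset.measurable_sum _ fun z _ => (hTm z).abs).aestronglyMeasurable
    · refine (add_le_add h2 h3).trans (le_of_eq ?_)
      push_cast
      ring

end ControlProblem

/-! ### The error bound. -/

theorem mainTheorem2 :
    ∃ c : ℝ, 0 < c ∧
      ∀ (Ω 𝒳 𝒦 ℒ : Type*) [MeasurableSpace Ω] [MeasurableSpace 𝒳] [Fintype 𝒦] [Fintype ℒ]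
        (J M : ℕ) (Q : ControlProblem Ω 𝒳 𝒦 ℒ J) (C_H W δ D : ℝ)
        (Ψ : ℕ → Set (𝒳 → ℝ)) (p : ℕ → ℒ → Sample 𝒳 J M → 𝒳 → ℝ),
        2 ≤ Fintype.card ℒ →
        1 ≤ M →
        (∀ j ≤ J, ∀ a y x, |Q.H j a y x| ≤ C_H) →
        W = J * C_H →
        1 ≤ W →
        0 < δ →
        0 < D →
        (∀ j < J, ∀ ψ ∈ Ψ j, Measurable ψ) →
        Q.IsEmpiricalProjection W Ψ p →
        (∀ j < J, (⨆ z : ℒ, ⨅ w ∈ Ψ j,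
          eLpNorm (fun q : 𝒳 × Sample 𝒳 J M => Q.contTilde W p j z q.2 q.1 - w q.1) 2
            ((Q.stateLaw j).prod (Q.sampleLaw M))) ≤ ENNReal.ofReal δ) →
        (∀ j < J, (functionVCDim (Ψ j) : ℝ≥0∞) ≤ ENNReal.ofReal D) →
        ∀ j < J,
          MemLp (fun q : 𝒳 × Sample 𝒳 J M =>
              ⨆ z : ℒ, |Q.estValue W p j z q.2 q.1 - Q.value j z q.1|) 2
            ((Q.stateLaw j).prod (Q.sampleLaw M)) ∧
          eLpNorm (fun q : 𝒳 × Sample 𝒳 J M =>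
              ⨆ z : ℒ, |Q.estValue W p j z q.2 q.1 - Q.value j z q.1|) 2
            ((Q.stateLaw j).prod (Q.sampleLaw M)) ≤
            ENNReal.ofReal
              ((Real.sqrt (c * W ^ 4 * ((1 + Real.log M) / M) * D) + Real.sqrt 2 * δ) *
                (((Fintype.card ℒ : ℝ) ^ (J - j + 1) - Fintype.card ℒ) /
                  (Fintype.card ℒ - 1))) ∧
          (Fintype.card ℒ : ℝ) ^ (J - j) ≤
            ((Fintype.card ℒ : ℝ) ^ (J - j + 1) - Fintype.card ℒ) / (Fintype.card ℒ - 1) ∧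
          ((Fintype.card ℒ : ℝ) ^ (J - j + 1) - Fintype.card ℒ) / (Fintype.card ℒ - 1) ≤
            2 * (Fintype.card ℒ : ℝ) ^ (J - j) := by
  -- 1792 = 448·2², the least squares constant at truncation level B = 2W.
  refine ⟨1792, by norm_num, ?_⟩
  intro Ω 𝒳 𝒦 ℒ _ _ _ _ J M Q C_H W δ D Ψ p hL hM hH hW hW1 hδ hD hΨ hp happ hvc j hj
  have hJ : (1 : ℝ) ≤ J := by exact_mod_cast (by omega : 1 ≤ J)
  -- The bound on H could be vacuous, so the sign is read off from J·C_H = W ≥ 1.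
  have hC : 0 ≤ C_H := by
    by_contra! h
    nlinarith
  have hCW : C_H ≤ W := by rw [hW]; nlinarith
  have hL' : (2 : ℝ) ≤ Fintype.card ℒ := by exact_mod_cast hL
  have hM' : (1 : ℝ) ≤ M := by exact_mod_cast hM
  have hlog : 0 ≤ Real.log M := Real.log_nonneg hM'
  have : Nonempty ℒ := Fintype.card_pos_iff.1 (by omega)
  have hval : (fun q : 𝒳 × Sample 𝒳 J M =>
      ⨆ z : ℒ, |Q.estValue W p j z q.2 q.1 - Q.value j z q.1|) = Q.estError W p j := by
    funext q
    simp_rw [Q.value_eq_dpValue hC hH hj.le]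
    rfl
  set ε : ℝ := Real.sqrt (1792 * W ^ 4 * ((1 + Real.log M) / M) * D) + Real.sqrt 2 * δ with hε
  have hε0 : 0 ≤ ε := by positivity
  -- The level is 2W because the responses v_{j+1,M} are bounded by C_H + W ≤ 2W, not by W.
  have hreg : ∀ j < J, ∀ z, eLpNorm (fun q : 𝒳 × Sample 𝒳 J M =>
      truncate (2 * W) (p j z q.2 q.1) - Q.contTilde W p j z q.2 q.1) 2
        ((Q.stateLaw j).prod (Q.sampleLaw M)) ≤ ENNReal.ofReal ε := by
    intro j hj z
    have hne : functionVCDim (Ψ j) ≠ ⊤ := fun h => by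
      have := hvc j hj
      rw [h] at this
      simp at this
    obtain ⟨d, hd⟩ := ENat.ne_top_iff_exists.1 hne
    have hdD : (d : ℝ) ≤ D := by
      have := hvc j hj
      rw [← hd, ENat.toENNReal_coe, ← ENNReal.ofReal_natCast] at this
      exact (ENNReal.ofReal_le_ofReal_iff hD.le).1 this
    refine le_ofReal_sqrt_add_of_sq_le (Ψ := Ψ j) (by positivity) hδ.le (fun w hw => ?_)
      ((le_iSup _ z).trans (happ j hj))
    refine (Q.eLpNorm_sq_regression_le hp (by linarith) hH (by linarith) (by linarith) hM hj
      (hΨ j hj) hd.ge z hw).trans ?_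
    -- The argument gives W²; W ≥ 1 is used to pass to W⁴.
    have hW4 : W ^ 2 ≤ W ^ 4 := pow_le_pow_right₀ hW1 (by norm_num)
    refine add_le_add_left (ENNReal.ofReal_le_ofReal ?_) _
    calc 448 * (2 * W) ^ 2 * ((1 + Real.log M) / M) * d
        = 1792 * W ^ 2 * ((1 + Real.log M) / M) * d := by ring
      _ ≤ 1792 * W ^ 4 * ((1 + Real.log M) / M) * D := by gcongr
  have hmain := Q.eLpNorm_estError_le hp hC hH hW (by linarith : 0 ≤ 2 * W) (by linarith) hreg hj.le
  have hbound : eLpNorm (Q.estError W p j) 2 ((Q.stateLaw j).prod (Q.sampleLaw M)) ≤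
      ENNReal.ofReal (ε * (((Fintype.card ℒ : ℝ) ^ (J - j + 1) - Fintype.card ℒ) /
        (Fintype.card ℒ - 1))) := by
    refine hmain.trans ?_
    rw [← ENNReal.ofReal_natCast (J - j), ← ENNReal.ofReal_natCast (Fintype.card ℒ),
      ← ENNReal.ofReal_mul (by positivity), ← ENNReal.ofReal_mul (by positivity)]
    refine ENNReal.ofReal_le_ofReal ?_
    have := mul_le_mul_of_nonneg_left (mul_le_geom_factor hL' (J - j)) hε0
    linarith
  rw [hval]
  exact ⟨⟨(Q.measurable_estError hp (by linarith) hj.le).aestronglyMeasurable,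
    hbound.trans_lt ENNReal.ofReal_lt_top⟩, hbound, pow_le_geom_factor hL' (by omega)⟩
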